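/- **Definitions.** Let $\mathfrak S_n$ be the permutations of $[n]=\{1,\dots,n\}$. A permutation $\sigma\in\mathfrak S_n$ is *irreducible* if $\{\sigma(1),\dots,\sigma(k)\}\ne\{n-k+1,\dots,n\}$ for $1\le k<n$. Let $L(\sigma)=\gamma_R(\sigma(1))\circ\sigma$, where $\gamma_R(i)$ is the cycle $(i+1\;i+2\;\cdots\;n)$, and $R(\sigma)=\sigma\circ\gamma_L(\sigma^{-1}(n))^{-1}$, where $\gamma_L(i)$ is the cycle $(i-1\;i-2\;\cdots\;1)$. Write $\sigma\sim\tau$ if $\tau$ is obtained from $\sigma$ by a word in $L,R$; the *(Rauzy) class* of $\sigma$ is $\{\tau:\sigma\sim\tau\}$. A class is irreducible if it is the class of an irreducible permutation. It is *primitive* if none of its permutations has an index $i<n$ with $\sigma(i+1)=\sigma(i)-1$ (a descent) or with $\sigma(i)=\sigma(1)+1$ and $\sigma(i+1)=n$ (a special descent). It is *exceptional* if it contains the identity or (for $n\ge 3$) the permutation $\mathrm{id}'_n$ given by $\mathrm{id}'_n(1)=1$, $\mathrm{id}'_n(2)=n-1$, $\mathrm{id}'_n(n)=n$ and $\mathrm{id}'_n(i)=i-1$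 otherwise. *Invariant $(\lambda,r,s)$.* Replace every bottom point $i^-$ and every top point $i^+$ ($1\le i\le n$) by a black and a white point $i_b^\pm,i_w^\pm$; join $i_b^-$ to $\sigma(i)_w^+$ and $i_w^-$ to $\sigma(i)_b^+$ for all $i$; join $i_w^\pm$ to $(i+1)_b^\pm$ by an arc for $1\le i<n$; and join $n_w^+$ to $1_b^-$. The result is a set of closed cycles and one open path, from $1_b^+$ to $n_w^-$. The length of a cycle or path is the number of top arcs $i_w^+ - (i+1)_b^+$ in it. The *rank* $r$ is the length of the open path, and $\lambda$ is the multiset of the lengths of the closed cycles. The sign $s\in\{-1,0,1\}$ is the sign of $\sum_{I\subseteq[n]}(-1)^{|I|+\chi(I)}$, where $\chi(I)$ is the number of pairs $i<j$ in $I$ with $\sigma(i)<\sigma(j)$. The triple $(\lambda,r,s)$ is constant on irreducible classes. *Operator $T$.* For $n\ge1$ and $\sigma\in\mathfrak S_n$, $T(\sigma)\in\mathfrak S_{n+2}$ is the permutation with one-line notation $(\sigma(1)+2,\ 1,\ \sigma(1)+1,\ \sigma'(2),\dots,\sigma'(n))$, where $\sigma'(i)=\sigma(i)+1$ if $\sigma(i)<\sigma(1)$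 and $\sigma'(i)=\sigma(i)+2$ if $\sigma(i)>\sigma(1)$. **Theorem (Pullback of $T$).** Let $n\ge 1$. 1. For every non-exceptional primitive irreducible class $C$ of size $n+2$ with rank $r>2$ there is an irreducible $\sigma\in\mathfrak S_n$ with $T(\sigma)\in C$. 2. Let $n\ge2$. There is a (necessarily unique) map $\bar T$ from the irreducible classes of size $n$ to the irreducible classes of size $n+2$ such that $T(\sigma)\in\bar T(B)$ for every irreducible class $B$ of size $n$ and every $\sigma\in B$. Every non-exceptional primitive irreducible class of size $n+2$ with rank $r>2$ is $\bar T(B)$ for some primitive irreducible class $B$ of size $n$. Moreover, $\bar T$ is a pullback function onto these classes, with respect to the equivalence relation of having the same invariant $(\lambda,r,s)$: this relation is compatible with $\bar T$, which hence induces a map $\tilde T$ on the equivalence classes, and for every non-exceptional primitive irreducible class $C$ of size $n+2$ with rank $r>2$ and every equivalence class $y$ of irreducible classes of size $n$ such that $\tilde T(y)$ is the equivalence class of $C$, there is $B\in y$ with $\bar T(B)=C$. -/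

import Mathlib

namespace Rauzy

open Equiv

/-! Permutations of size `m + 1` are elements of `Perm (Fin (m + 1))`. The indices `1, …, m + 1`
of the mathematical text are `0, …, m` here. In the diagram of `σ`, the edge number `i` joins the
bottom point `i` to the top point `σ i`. -/

/-- The cycle `(i-1 i-2 ⋯ 1)`, fixing all indices from `i` on. -/
def gammaL {m : ℕ} (i : Fin (m + 1)) : Perm (Fin (m + 1)) :=
  ((List.finRange (m + 1)).filter (fun j => j < i)).reverse.formPerm

/-- The cycle `(i+1 i+2 ⋯ n)`, fixing all indices up to `i`. -/
def gammaR {m : ℕ} (i : Fin (m + 1)) : Perm (Fin (m + 1)) :=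
  ((List.finRange (m + 1)).filter (fun j => i < j)).formPerm

/-- The operator `L`: the top endpoints to the right of the top endpoint of the edge `(1, σ 1)`
are rotated by one position. -/
def opL {m : ℕ} (σ : Perm (Fin (m + 1))) : Perm (Fin (m + 1)) :=
  gammaR (σ 0) * σ

/-- The operator `R`: the bottom endpoints to the left of the bottom endpoint of the edge
`(σ⁻¹ n, n)` are rotated by one position. -/
def opR {m : ℕ} (σ : Perm (Fin (m + 1))) : Perm (Fin (m + 1)) :=
  σ * (gammaL (σ⁻¹ (Fin.last m)))⁻¹

/-- `τ` is the image of `σ` under some word in the operators `L` and `R`. -/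
def Connected {m : ℕ} (σ τ : Perm (Fin (m + 1))) : Prop :=
  Relation.ReflTransGen (fun α β => β = opL α ∨ β = opR α) σ τ

/-- The class of `σ`. -/
def classOf {m : ℕ} (σ : Perm (Fin (m + 1))) : Set (Perm (Fin (m + 1))) :=
  {τ | Connected σ τ}

/-- `{σ 1, …, σ k} ≠ {n - k + 1, …, n}` for `1 ≤ k < n`, where `n = m + 1`. -/
def IsIrreducible {m : ℕ} (σ : Perm (Fin (m + 1))) : Prop :=
  ∀ k : ℕ, 1 ≤ k → k < m + 1 →
    σ '' {i : Fin (m + 1) | (i : ℕ) < k} ≠ {j : Fin (m + 1) | m + 1 - k ≤ (j : ℕ)}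

/-- The edge `i` is a descent: `σ (i + 1) = σ i - 1`. -/
def IsDescent {m : ℕ} (σ : Perm (Fin (m + 1))) (i : Fin m) : Prop :=
  (σ i.succ : ℕ) + 1 = σ i.castSucc

/-- The edge `i` is a special descent: `σ 1 = σ i - 1` and `σ (i + 1) = n`. -/
def IsSpecialDescent {m : ℕ} (σ : Perm (Fin (m + 1))) (i : Fin m) : Prop :=
  (σ 0 : ℕ) + 1 = σ i.castSucc ∧ σ i.succ = Fin.last m

/-- `σ` has no descents, special or not. -/
def IsPrimitive {m : ℕ} (σ : Perm (Fin (m + 1))) : Prop :=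
  ∀ i : Fin m, ¬ IsDescent σ i ∧ ¬ IsSpecialDescent σ i

/-! ### The cycle invariant -/

/-- The endpoints in the doubled diagram of a permutation of size `n`: every endpoint of an edge,
at the bottom (`-`) or at the top (`+`), is replaced by a black one and a white one. -/
inductive Endpoint (n : ℕ) : Type
  | botBlack (i : Fin n) : Endpoint n
  | botWhite (i : Fin n) : Endpoint n
  | topBlack (j : Fin n) : Endpoint n
  | topWhite (j : Fin n) : Endpoint n

/-- The lines of the doubled diagram: the two crossing copies of every edge, the arcs between
neighbouring bottom or top points, and the `-1` mark, which joins the top-right endpoint to the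
bottom-left one. -/
inductive Link {m : ℕ} (σ : Perm (Fin (m + 1))) : Endpoint (m + 1) → Endpoint (m + 1) → Prop
  | edgeBW (i : Fin (m + 1)) : Link σ (.botBlack i) (.topWhite (σ i))
  | edgeWB (i : Fin (m + 1)) : Link σ (.botWhite i) (.topBlack (σ i))
  | arcBot (i : Fin m) : Link σ (.botWhite i.castSucc) (.botBlack i.succ)
  | arcTop (j : Fin m) : Link σ (.topWhite j.castSucc) (.topBlack j.succ)
  | mark : Link σ (.topWhite (Fin.last m)) (.botBlack 0)

/-- The doubled diagram as a graph. Its connected components are a number of closed cycles and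
one open path, the rank path. -/
def diagram {m : ℕ} (σ : Perm (Fin (m + 1))) : SimpleGraph (Endpoint (m + 1)) :=
  SimpleGraph.fromRel (Link σ)

/-- The number of top arcs in a component. -/
noncomputable def pathLength {m : ℕ} (σ : Perm (Fin (m + 1)))
    (c : (diagram σ).ConnectedComponent) : ℕ :=
  {j : Fin m | (diagram σ).connectedComponentMk (.topWhite j.castSucc) = c}.ncard

/-- The component of the top-left endpoint. -/
def rankPath {m : ℕ} (σ : Perm (Fin (m + 1))) : (diagram σ).ConnectedComponent :=
  (diagram σ).connectedComponentMk (.topBlack 0)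

/-- The rank `r` of `σ`. -/
noncomputable def rank {m : ℕ} (σ : Perm (Fin (m + 1))) : ℕ :=
  pathLength σ (rankPath σ)

instance (n : ℕ) : Finite (Endpoint n) :=
  Finite.of_injective
    (fun p : Endpoint n => match p with
      | .botBlack i => ((false, false, i) : Bool × Bool × Fin n)
      | .botWhite i => (false, true, i)
      | .topBlack i => (true, false, i)
      | .topWhite i => (true, true, i))
    (by rintro (i | i | i | i) (j | j | j | j) h <;> simp_all)

instance {m : ℕ} (σ : Perm (Fin (m + 1))) : Finite (diagram σ).ConnectedComponent :=
  Quot.finite _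

/-- The cycle structure `λ` of `σ`: the multiset of the lengths of all closed cycles. -/
noncomputable def cycleStructure {m : ℕ} (σ : Perm (Fin (m + 1))) : Multiset ℕ :=
  (Set.toFinite {c | c ≠ rankPath σ}).toFinset.val.map (pathLength σ)

/-! ### The sign invariant -/

/-- The number of pairs of non-crossing edges in a set `I` of edges. -/
def nonCrossings {m : ℕ} (σ : Perm (Fin (m + 1))) (I : Finset (Fin (m + 1))) : ℕ :=
  ((I ×ˢ I).filter (fun p => p.1 < p.2 ∧ σ p.1 < σ p.2)).card

/-- The Arf invariant. -/
def arf {m : ℕ} (σ : Perm (Fin (m + 1))) : ℤ :=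
  ∑ I : Finset (Fin (m + 1)), (-1) ^ (I.card + nonCrossings σ I)

/-- The invariant `(λ, r, s)`, where `s` is the sign of the Arf invariant. -/
noncomputable def invariant {m : ℕ} (σ : Perm (Fin (m + 1))) : Multiset ℕ × ℕ × SignType :=
  (cycleStructure σ, rank σ, SignType.sign (arf σ))

/-! ### Classes -/

/-- The classes of irreducible permutations of size `m + 1`. -/
def RauzyClass (m : ℕ) : Type :=
  {C : Set (Perm (Fin (m + 1))) // ∃ σ, IsIrreducible σ ∧ C = classOf σ}

instance (m : ℕ) : Membership (Perm (Fin (m + 1))) (RauzyClass m) :=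
  ⟨fun C σ => σ ∈ C.1⟩

/-- All permutations of the class are primitive. -/
def RauzyClass.Primitive {m : ℕ} (C : RauzyClass m) : Prop :=
  ∀ σ ∈ C, IsPrimitive σ

/-- `σ` is the permutation `id'`: with `n = m + 1` and indices from `1` on, `σ 1 = 1`,
`σ 2 = n - 1`, `σ n = n`, and `σ i = i - 1` elsewhere. -/
def IsIdPrime {m : ℕ} (σ : Perm (Fin (m + 1))) : Prop :=
  2 ≤ m ∧ ∀ i : Fin (m + 1), (σ i : ℕ) =
    if (i : ℕ) = 0 then 0 else if (i : ℕ) = 1 then m - 1 else if (i : ℕ) = m then m else i - 1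

/-- The class is that of the identity or that of `id'`. -/
def RauzyClass.Exceptional {m : ℕ} (C : RauzyClass m) : Prop :=
  1 ∈ C ∨ ∃ σ ∈ C, IsIdPrime σ

/-- The values of the invariant on a class. As the invariant is constant on classes, this is the
singleton of the invariant of the class. -/
def RauzyClass.invariants {m : ℕ} (C : RauzyClass m) : Set (Multiset ℕ × ℕ × SignType) :=
  {v | ∃ σ ∈ C, invariant σ = v}

/-- Two classes are equivalent if they have the same invariant. -/
def sameInvariant (m : ℕ) : Setoid (RauzyClass m) :=
  Setoid.ker RauzyClass.invariants

/-- The non-exceptional primitive classes of rank larger than `2`. -/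
def targetClasses (m : ℕ) : Set (RauzyClass m) :=
  {C | ¬ C.Exceptional ∧ C.Primitive ∧ ∀ σ ∈ C, 2 < rank σ}

/-! ### The operator `T` -/

/-- Add an edge to the diagram of `σ`, from position `p` at the bottom to position `q` at the top
(positions in the new diagram), without changing the relative order of the other endpoints. -/
def insertEdge {k : ℕ} (σ : Perm (Fin k)) (p q : Fin (k + 1)) : Perm (Fin (k + 1)) :=
  (finSuccEquiv' p).trans ((Equiv.optionCongr σ).trans (finSuccEquiv' q).symm)

/-- The operator `T`, the square constructor at the first column for the one-point matrix put in
the bottom-left block. The edge `(1, σ 1)` is doubled into two crossing edges with neighbouring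
endpoints, and then an edge is added whose bottom endpoint lies between those of these two edges
and whose top endpoint is the leftmost one. In one-line notation with values from `1` on,
`T σ = (σ 1 + 2, 1, σ 1 + 1, …)`, where the entry `σ i` with `i ≥ 2` becomes `σ i + 1` if
`σ i < σ 1` and `σ i + 2` if `σ i > σ 1`. -/
def opT {m : ℕ} (σ : Perm (Fin (m + 1))) : Perm (Fin (m + 3)) :=
  insertEdge (insertEdge σ 0 (σ 0).succ) 1 0

/-! ### Pullback functions -/

/-- `f : X → X'` is compatible with the equivalence relations `s` and `s'`, and, over the subset
`S` of `X'`, it is a pullback function for the induced map `f'` on equivalence classes: for all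
`x'` in `S` and all `y` with `f' y` the class of `x'`, there is an `x` in `y` with `f x = x'`. -/
def IsPullbackOver {X X' : Type*} (s : Setoid X) (s' : Setoid X') (f : X → X') (S : Set X') :
    Prop :=
  ∃ f' : Quotient s → Quotient s',
    (∀ x, f' (Quotient.mk s x) = Quotient.mk s' (f x)) ∧
    ∀ x' ∈ S, ∀ y, f' y = Quotient.mk s' x' → ∃ x, Quotient.mk s x = y ∧ f x = x'

end Rauzy

namespace Rauzy
open Equiv

/-! ### The two dynamics in coordinates -/

/-! The proof follows edges instead of positions. The edges of the diagram get labels that `L` and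
`R` carry along. The rank path, started at the top-left endpoint, visits the edges in a certain
order, and the relation "`e'` comes next after `e`" (`Labelled.Follows`) is preserved by both
operators.

An irreducible class contains a permutation with σ(1) = 1 (`IsIrreducible.exists_standard`), and
rotating the top endpoints gives a normal state: the first two edges `o`, `b` join 1 to 1 and 2 to
2. Rank larger than 2 provides the two edges `t`, `f` that come after `o` on the rank path, and
ensures that the path does not end at `f`. If some reachable normal state has `f` as its second
edge, then one rotation of the bottom endpoints gives a permutation starting with 3, 1, 2, which is
`T` of a standard permutation.

Suppose that no such state is reachable (`Labelled.Trapped`). In a normal state any two crossing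
edges `g`, `z` other than the first two allow an exchange of blocks that makes `g`, the left one at
the bottom, the second edge (`Labelled.IsNormal.exists_exchange`). Hence no edge starting to the
right of `f` crosses `f`. The same holds in every state reached by exchanges, which rules out one
pattern of crossings after another; where two crossing edges are neighbours both at the bottom and
at the top, primitivity rules them out. In the end no two edges cross, the permutation is the
identity, and the class is exceptional.

The map on classes exists because `T` commutes with `L`, and `T (R σ)` is reached from `T σ` by an
exchange between rotations (`connected_opT_opR`). `T` only prolongs the rank path by two top arcs
and doubles the Arf sum, so (λ, r, s) becomes (λ, r + 2, s). This is injective in the invariant, and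
the pullback property follows from surjectivity. -/

theorem filter_gt_finRange {n : ℕ} (i : Fin n) :
    (List.finRange n).filter (fun j => i < j) = (List.finRange n).drop (i + 1) := by
  conv_lhs => rw [← List.take_append_drop (i + 1) (List.finRange n)]
  rw [List.filter_append, List.filter_eq_nil_iff.2, List.filter_eq_self.2, List.nil_append]
  · intro a ha
    obtain ⟨k, hk, rfl⟩ := List.mem_drop_iff_getElem.1 ha
    simp [Fin.lt_def]; omega
  · intro a ha
    obtain ⟨k, hk, rfl⟩ := List.mem_take_iff_getElem.1 ha
    simp [Fin.lt_def] at hk ⊢; omega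

theorem filter_lt_finRange {n : ℕ} (i : Fin n) :
    (List.finRange n).filter (fun j => j < i) = (List.finRange n).take i := by
  conv_lhs => rw [← List.take_append_drop i (List.finRange n)]
  rw [List.filter_append, List.filter_eq_self.2, List.filter_eq_nil_iff.2, List.append_nil]
  · intro a ha
    obtain ⟨k, hk, rfl⟩ := List.mem_drop_iff_getElem.1 ha
    simp [Fin.lt_def]
  · intro a ha
    obtain ⟨k, hk, rfl⟩ := List.mem_take_iff_getElem.1 ha
    simp [Fin.lt_def] at hk ⊢; omega

theorem gammaR_val {m : ℕ} (i j : Fin (m + 1)) :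
    (gammaR i j : ℕ) = if (j : ℕ) ≤ i then (j : ℕ) else if (j : ℕ) = m then (i : ℕ) + 1 else (j : ℕ) + 1 := by
  have hnd : ((List.finRange (m + 1)).drop (i + 1)).Nodup :=
    (List.nodup_finRange _).sublist (List.drop_sublist _ _)
  rw [gammaR, filter_gt_finRange]
  split_ifs with h1 h2
  · rw [List.formPerm_apply_of_notMem]
    intro h
    obtain ⟨k, hk, rfl⟩ := List.mem_drop_iff_getElem.1 h
    simp at h1; omega
  all_goals
    have hl : (j : ℕ) - (i + 1) < ((List.finRange (m + 1)).drop (i + 1)).length := by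
      simp; omega
    have hj : j = ((List.finRange (m + 1)).drop (i + 1))[(j : ℕ) - (i + 1)] := by
      ext; simp; omega
    rw [hj, List.formPerm_apply_getElem _ hnd]
    simp only [List.getElem_drop, List.getElem_finRange, List.length_drop, List.length_finRange,
      Fin.val_cast]
  · rw [show (j : ℕ) - (i + 1) + 1 = m + 1 - (i + 1) by omega, Nat.mod_self]
  · rw [Nat.mod_eq_of_lt (by omega)]; omega

theorem gammaL_inv_val {m : ℕ} (i j : Fin (m + 1)) :
    (((gammaL i)⁻¹ : Perm (Fin (m + 1))) j : ℕ) =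
      if (i : ℕ) ≤ j then (j : ℕ) else if (j : ℕ) + 1 = i then 0 else (j : ℕ) + 1 := by
  have hnd : ((List.finRange (m + 1)).take i).Nodup :=
    (List.nodup_finRange _).sublist (List.take_sublist _ _)
  rw [gammaL, filter_lt_finRange, List.formPerm_reverse, inv_inv]
  split_ifs with h1 h2
  · rw [List.formPerm_apply_of_notMem]
    intro h
    obtain ⟨k, hk, rfl⟩ := List.mem_take_iff_getElem.1 h
    simp at hk h1; omega
  all_goals
    have hl : (j : ℕ) < ((List.finRange (m + 1)).take i).length := by
      simp; omega
    have hj : j = ((List.finRange (m + 1)).take i)[(j : ℕ)] := by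
      ext; simp
    have hlen : ((List.finRange (m + 1)).take i).length = i := by simp
    conv_lhs => rw [hj, List.formPerm_apply_getElem _ hnd]
    simp only [List.getElem_take, List.getElem_finRange, Fin.val_cast, hlen]
  · rw [h2, Nat.mod_self]
  · rw [Nat.mod_eq_of_lt (by omega)]

theorem gammaL_val {m : ℕ} (i j : Fin (m + 1)) :
    (gammaL i j : ℕ) = if (i : ℕ) ≤ j then (j : ℕ) else if (j : ℕ) = 0 then (i : ℕ) - 1 else (j : ℕ) - 1 := by
  obtain ⟨k, rfl⟩ : ∃ k, j = (gammaL i)⁻¹ k := ⟨gammaL i j, by simp⟩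
  rw [show gammaL i ((gammaL i)⁻¹ k) = k from (gammaL i).apply_symm_apply k, gammaL_inv_val]
  split_ifs <;> first | omega | contradiction

theorem opL_val {m : ℕ} (σ : Perm (Fin (m + 1))) (i : Fin (m + 1)) :
    (opL σ i : ℕ) = if (σ i : ℕ) ≤ σ 0 then (σ i : ℕ) else
      if (σ i : ℕ) = m then (σ 0 : ℕ) + 1 else (σ i : ℕ) + 1 := by
  rw [opL, Perm.mul_apply, gammaR_val]

theorem opL_zero {m : ℕ} (σ : Perm (Fin (m + 1))) : opL σ 0 = σ 0 := by
  ext; simp [opL_val]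

theorem opR_symm_last {m : ℕ} (σ : Perm (Fin (m + 1))) :
    (opR σ)⁻¹ (Fin.last m) = σ⁻¹ (Fin.last m) := by
  rw [opR, mul_inv_rev, inv_inv, Perm.mul_apply]
  ext; simp [gammaL_val]

theorem opL_injective {m : ℕ} : Function.Injective (opL (m := m)) := by
  intro σ τ h
  have h0 : σ 0 = τ 0 := by rw [← opL_zero σ, h, opL_zero]
  rw [opL, opL, h0] at h
  exact mul_left_cancel h

theorem opR_injective {m : ℕ} : Function.Injective (opR (m := m)) := by
  intro σ τ h
  have h0 : σ⁻¹ (Fin.last m) = τ⁻¹ (Fin.last m) := by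
    rw [← opR_symm_last σ, h, opR_symm_last]
  rw [opR, opR, h0] at h
  exact mul_right_cancel h

theorem Connected.refl {m : ℕ} (σ : Perm (Fin (m + 1))) : Connected σ σ :=
  Relation.ReflTransGen.refl

theorem Connected.trans {m : ℕ} {σ τ ρ : Perm (Fin (m + 1))} (h : Connected σ τ)
    (h' : Connected τ ρ) : Connected σ ρ :=
  Relation.ReflTransGen.trans h h'

theorem connected_opL {m : ℕ} (σ : Perm (Fin (m + 1))) : Connected σ (opL σ) :=
  Relation.ReflTransGen.single (Or.inl rfl)

theorem connected_opR {m : ℕ} (σ : Perm (Fin (m + 1))) : Connected σ (opR σ) :=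
  Relation.ReflTransGen.single (Or.inr rfl)

/-- An injective self-map of a finite set has only periodic points, so its inverse at a point is a
forward iterate. This makes `Connected` symmetric. -/
theorem connected_apply_symm {m : ℕ} {f : Perm (Fin (m + 1)) → Perm (Fin (m + 1))}
    (hf : Function.Injective f) (hc : ∀ σ, Connected σ (f σ)) (σ : Perm (Fin (m + 1))) :
    Connected (f σ) σ := by
  obtain ⟨n, hn, hp⟩ := hf.mem_periodicPts σ
  have key : ∀ k, Connected (f σ) (f^[k] (f σ)) := by
    intro k
    induction k with
    | zero => exact Connected.refl _
    | succ k ih => rw [Function.iterate_succ_apply']; exact ih.trans (hc _)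
  have := key (n - 1)
  rwa [← Function.iterate_succ_apply, Nat.succ_eq_add_one, Nat.sub_add_cancel hn, hp] at this

theorem Connected.symm {m : ℕ} {σ τ : Perm (Fin (m + 1))} (h : Connected σ τ) :
    Connected τ σ := by
  induction h with
  | refl => exact Connected.refl _
  | tail _ h ih =>
    rcases h with rfl | rfl
    · exact (connected_apply_symm opL_injective connected_opL _).trans ih
    · exact (connected_apply_symm opR_injective connected_opR _).trans ih

theorem classOf_eq {m : ℕ} {σ τ : Perm (Fin (m + 1))} (h : Connected σ τ) :
    classOf σ = classOf τ :=
  Set.ext fun _ => ⟨h.symm.trans, h.trans⟩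

/-! ### Irreducibility along the dynamics -/

theorem image_eq_iff {m : ℕ} (σ : Perm (Fin (m + 1))) (k : ℕ) :
    σ '' {i : Fin (m + 1) | (i : ℕ) < k} = {j : Fin (m + 1) | m + 1 - k ≤ (j : ℕ)} ↔
      ∀ i : Fin (m + 1), (i : ℕ) < k ↔ m + 1 - k ≤ (σ i : ℕ) := by
  rw [Set.ext_iff, σ.surjective.forall]
  simp

theorem not_isIrreducible_iff {m : ℕ} (σ : Perm (Fin (m + 1))) :
    ¬ IsIrreducible σ ↔ ∃ k, 1 ≤ k ∧ k < m + 1 ∧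
      ∀ i : Fin (m + 1), (i : ℕ) < k ↔ m + 1 - k ≤ (σ i : ℕ) := by
  simp only [IsIrreducible, ne_eq, image_eq_iff]
  push Not
  rfl

/-- The first edge belongs to the reducing block, so `L` only permutes top points inside the block
of the last `k`. -/
theorem opL_reducible {m : ℕ} {σ : Perm (Fin (m + 1))} (h : ¬ IsIrreducible σ) :
    ¬ IsIrreducible (opL σ) := by
  rw [not_isIrreducible_iff] at h ⊢
  obtain ⟨k, h1, h2, h⟩ := h
  refine ⟨k, h1, h2, fun i => ?_⟩
  have h0 := (h 0).1 h1
  rw [opL_val, h i]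
  split_ifs <;> omega

/-- The edge with the last top endpoint starts among the first `k` bottom points, so `R` only
permutes points among these. -/
theorem opR_reducible {m : ℕ} {σ : Perm (Fin (m + 1))} (h : ¬ IsIrreducible σ) :
    ¬ IsIrreducible (opR σ) := by
  rw [not_isIrreducible_iff] at h ⊢
  obtain ⟨k, h1, h2, h⟩ := h
  refine ⟨k, h1, h2, fun i => ?_⟩
  have h0 := (h (σ⁻¹ (Fin.last m))).2 (by simp; omega)
  rw [opR, Perm.mul_apply, ← h, gammaL_inv_val]
  split_ifs <;> omega

theorem IsIrreducible.of_connected {m : ℕ} {σ τ : Perm (Fin (m + 1))} (hσ : IsIrreducible σ)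
    (h : Connected σ τ) : IsIrreducible τ := by
  have h' := h.symm
  clear h
  by_contra hτ
  induction h' with
  | refl => exact hτ hσ
  | tail _ h ih =>
    rcases h with rfl | rfl
    · exact opL_reducible ih hσ
    · exact opR_reducible ih hσ

theorem isIrreducible_of_apply_zero {m : ℕ} {σ : Perm (Fin (m + 1))} (h : σ 0 = 0) :
    IsIrreducible σ := by
  by_contra hσ
  obtain ⟨k, h1, h2, h3⟩ := (not_isIrreducible_iff σ).1 hσ
  have := (h3 0).1 h1
  rw [h] at this
  simp at this; omega

end Rauzy

namespace Rauzy
open Equiv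

/-! ### Labelled permutations -/

/-- A permutation whose edges carry the labels `Fin (m + 1)`: the first component gives the bottom
position of an edge, the second its top position. -/
def Labelled (m : ℕ) : Type := Perm (Fin (m + 1)) × Perm (Fin (m + 1))

namespace Labelled

variable {m : ℕ}

/-- The bottom position of an edge. -/
def pos (s : Labelled m) (e : Fin (m + 1)) : ℕ := s.1 e

/-- The top position of an edge. -/
def val (s : Labelled m) (e : Fin (m + 1)) : ℕ := s.2 e

/-- The permutation obtained by forgetting the labels. -/
def perm (s : Labelled m) : Perm (Fin (m + 1)) := s.2 * s.1⁻¹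

/-- The operator `L` on labelled permutations. -/
def stepL (s : Labelled m) : Labelled m := (s.1, gammaR (s.perm 0) * s.2)

/-- The operator `R` on labelled permutations. -/
def stepR (s : Labelled m) : Labelled m := (gammaL (s.perm⁻¹ (Fin.last m)) * s.1, s.2)

/-- `t` is the image of `s` under some word in `L` and `R`. -/
def Tracks (s t : Labelled m) : Prop :=
  Relation.ReflTransGen (fun a b => b = stepL a ∨ b = stepR a) s t

theorem perm_stepL (s : Labelled m) : s.stepL.perm = opL s.perm := by
  simp only [perm, stepL, opL, mul_assoc]

theorem perm_stepR (s : Labelled m) : s.stepR.perm = opR s.perm := by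
  simp only [perm, stepR, opR, mul_assoc, mul_inv_rev]

theorem Tracks.connected {s t : Labelled m} (h : Tracks s t) : Connected s.perm t.perm := by
  induction h with
  | refl => exact Connected.refl _
  | tail _ h ih =>
    rcases h with rfl | rfl
    · rw [perm_stepL]; exact ih.trans (connected_opL _)
    · rw [perm_stepR]; exact ih.trans (connected_opR _)

theorem Tracks.refl (s : Labelled m) : Tracks s s := Relation.ReflTransGen.refl

theorem Tracks.trans {s t u : Labelled m} (h : Tracks s t) (h' : Tracks t u) : Tracks s u :=
  Relation.ReflTransGen.trans h h'

theorem tracks_stepL (s : Labelled m) : Tracks s s.stepL :=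
  Relation.ReflTransGen.single (Or.inl rfl)

theorem tracks_stepR (s : Labelled m) : Tracks s s.stepR :=
  Relation.ReflTransGen.single (Or.inr rfl)

theorem pos_le (s : Labelled m) (e : Fin (m + 1)) : s.pos e ≤ m := Nat.lt_succ_iff.1 (s.1 e).2

theorem val_le (s : Labelled m) (e : Fin (m + 1)) : s.val e ≤ m := Nat.lt_succ_iff.1 (s.2 e).2

theorem pos_inj (s : Labelled m) {e e' : Fin (m + 1)} : s.pos e = s.pos e' ↔ e = e' := by
  simp [pos, Fin.val_inj]

theorem val_inj (s : Labelled m) {e e' : Fin (m + 1)} : s.val e = s.val e' ↔ e = e' := by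
  simp [val, Fin.val_inj]

theorem exists_pos_eq (s : Labelled m) {k : ℕ} (hk : k ≤ m) : ∃ e, s.pos e = k :=
  ⟨s.1⁻¹ ⟨k, Nat.lt_succ_iff.2 hk⟩, by simp [pos]⟩

theorem exists_val_eq (s : Labelled m) {k : ℕ} (hk : k ≤ m) : ∃ e, s.val e = k :=
  ⟨s.2⁻¹ ⟨k, Nat.lt_succ_iff.2 hk⟩, by simp [val]⟩

theorem perm_apply (s : Labelled m) (e : Fin (m + 1)) : s.perm (s.1 e) = s.2 e := by
  simp [perm]

theorem perm_val (s : Labelled m) {i e : Fin (m + 1)} (h : s.pos e = i) :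
    (s.perm i : ℕ) = s.val e := by
  rw [← Fin.ext (a := s.1 e) (b := i) h, perm_apply, val]

theorem val_stepR (s : Labelled m) (e : Fin (m + 1)) : s.stepR.val e = s.val e := rfl

theorem val_stepL (s : Labelled m) {o : Fin (m + 1)} (ho : s.pos o = 0) (e : Fin (m + 1)) :
    s.stepL.val e = if s.val e ≤ s.val o then s.val e else
      if s.val e = m then s.val o + 1 else s.val e + 1 := by
  have : (s.perm 0 : ℕ) = s.val o := s.perm_val (by simpa using ho)
  rw [val, stepL]
  simp only [Perm.mul_apply, gammaR_val, this]
  rfl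

theorem pos_stepR (s : Labelled m) {w : Fin (m + 1)} (hw : s.val w = m) (e : Fin (m + 1)) :
    s.stepR.pos e = if s.pos w ≤ s.pos e then s.pos e else
      if s.pos e = 0 then s.pos w - 1 else s.pos e - 1 := by
  have : (s.perm⁻¹ (Fin.last m) : ℕ) = s.pos w := by
    have : s.2 w = Fin.last m := Fin.ext hw
    rw [← this, ← perm_apply, pos]
    simp
  rw [pos, stepR]
  simp only [Perm.mul_apply, gammaL_val, this]
  rfl

/-- The top endpoints to the right of the first edge can be rotated so that a given one of them
comes last. -/
theorem exists_rotate_val_last (s : Labelled m) {o y : Fin (m + 1)} (ho : s.pos o = 0)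
    (hy : s.val o < s.val y) :
    ∃ t, Tracks s t ∧ (∀ e, t.pos e = s.pos e) ∧ ∀ e, t.val e =
      if s.val e ≤ s.val o then s.val e else
      if s.val e ≤ s.val y then s.val e + (m - s.val y) else s.val o + (s.val e - s.val y) := by
  -- `d` is the number of applications of `L` that push `y` to the last place.
  obtain ⟨d, hd⟩ : ∃ d, d + s.val y = m := ⟨m - s.val y, by have := s.val_le y; omega⟩
  induction d generalizing s with
  | zero =>
    refine ⟨s, .refl s, fun _ => rfl, fun e => ?_⟩
    have := s.val_le e
    split_ifs <;> omega
  | succ d ih =>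
    have hv := s.val_stepL ho
    have ho' := hv o
    have hy' := hv y
    rw [if_pos le_rfl] at ho'
    rw [if_neg (by omega), if_neg (by omega)] at hy'
    obtain ⟨t, h1, h2, h3⟩ := ih s.stepL ho (by omega) (by omega)
    refine ⟨t, (tracks_stepL s).trans h1, h2, fun e => ?_⟩
    rw [h3, ho', hy', hv]
    have := s.val_le e
    split_ifs <;> omega

/-- The top endpoints to the right of the first edge can be rotated so that a given one of them
comes first. -/
theorem exists_rotate_val_first (s : Labelled m) {o y : Fin (m + 1)} (ho : s.pos o = 0)
    (hy : s.val o < s.val y) :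
    ∃ t, Tracks s t ∧ (∀ e, t.pos e = s.pos e) ∧ ∀ e, t.val e =
      if s.val e ≤ s.val o then s.val e else
      if s.val y ≤ s.val e then s.val e - s.val y + s.val o + 1 else s.val e + m + 1 - s.val y := by
  have hym := s.val_le y
  by_cases h : s.val y = s.val o + 1
  · refine ⟨s, .refl s, fun _ => rfl, fun e => ?_⟩
    split_ifs <;> omega
  -- `y` comes first as soon as its left neighbour `z` comes last.
  · obtain ⟨z, hz⟩ := s.exists_val_eq (k := s.val y - 1) (by omega)
    obtain ⟨t, h1, h2, h3⟩ := s.exists_rotate_val_last ho (y := z) (by omega)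
    refine ⟨t, h1, h2, fun e => ?_⟩
    rw [h3, hz]
    have := s.val_le e
    split_ifs <;> omega

/-- The bottom endpoints to the left of the edge with the last top endpoint can be rotated so that
a given one of them comes first. -/
theorem exists_rotate_pos (s : Labelled m) {w x : Fin (m + 1)} (hw : s.val w = m)
    (hx : s.pos x < s.pos w) :
    ∃ t, Tracks s t ∧ (∀ e, t.val e = s.val e) ∧ ∀ e, t.pos e =
      if s.pos w ≤ s.pos e then s.pos e else
      if s.pos x ≤ s.pos e then s.pos e - s.pos x else s.pos e + (s.pos w - s.pos x) := by
  obtain ⟨d, hd⟩ : ∃ d, d = s.pos x := ⟨_, rfl⟩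
  induction d generalizing s with
  | zero =>
    refine ⟨s, .refl s, fun _ => rfl, fun e => ?_⟩
    split_ifs <;> omega
  | succ d ih =>
    have hv := s.pos_stepR hw
    have hw' := hv w
    have hx' := hv x
    rw [if_pos le_rfl] at hw'
    rw [if_neg (by omega), if_neg (by omega)] at hx'
    obtain ⟨t, h1, h2, h3⟩ := ih s.stepR hw (by omega) (by omega)
    refine ⟨t, (tracks_stepR s).trans h1, h2, fun e => ?_⟩
    rw [h3, hw', hx', hv]
    split_ifs <;> omega

/-! ### Normal states and the exchange of blocks -/

/-- The first edge has label `o` and top endpoint `0`, and the second edge has label `b` and top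
endpoint `1`. -/
structure IsNormal (s : Labelled m) (o b : Fin (m + 1)) : Prop where
  pos_fst : s.pos o = 0
  val_fst : s.val o = 0
  pos_snd : s.pos b = 1
  val_snd : s.val b = 1

/-- The state `t` arises from the normal state `s` by exchanging two blocks of bottom endpoints and
two blocks of top endpoints, with `g` as the new second edge. -/
structure IsExchange (s t : Labelled m) (g z : Fin (m + 1)) : Prop where
  tracks : Tracks s t
  pos_eq : ∀ e, t.pos e =
    if s.pos e = 0 then 0 else
    if s.pos e < s.pos g then s.pos e + (s.pos z - s.pos g) else
    if s.pos e < s.pos z then s.pos e - s.pos g + 1 else s.pos e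
  val_eq : ∀ e, t.val e =
    if s.val e = 0 then 0 else
    if s.val e = 1 then m - s.val g + s.val z + 1 else
    if s.val e ≤ s.val z then s.val e else
    if s.val e < s.val g then s.val e + (m - s.val g) + 1 else
    if s.val e = s.val g then 1 else s.val e - s.val g + s.val z

theorem IsExchange.isNormal {s t : Labelled m} {o b g z : Fin (m + 1)} (h : s.IsNormal o b)
    (hp : s.pos g < s.pos z) (hv : s.val z < s.val g) (hz : 1 < s.val z) (hx : s.IsExchange t g z)
    (hg : 1 < s.pos g) : t.IsNormal o g := by
  obtain ⟨h1, h2, h3, h4⟩ := h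
  have hgm := s.val_le g
  constructor
  · rw [hx.pos_eq, h1, if_pos rfl]
  · rw [hx.val_eq, h2, if_pos rfl]
  · rw [hx.pos_eq]; split_ifs <;> omega
  · rw [hx.val_eq]; split_ifs <;> omega

theorem IsNormal.exists_exchange {s : Labelled m} {o b g z : Fin (m + 1)} (h : s.IsNormal o b)
    (hp : s.pos g < s.pos z) (hv : s.val z < s.val g) (hz : 1 < s.val z) :
    ∃ t, s.IsExchange t g z ∧ t.IsNormal o g := by
  have hgb : 1 < s.pos g := by
    obtain ⟨h1, h2, h3, h4⟩ := h
    by_contra hlt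
    have : s.pos g = s.pos o ∨ s.pos g = s.pos b := by omega
    rcases this with h | h <;> rw [s.pos_inj] at h <;> subst h <;> omega
  suffices ∃ t, s.IsExchange t g z by
    obtain ⟨t, ht⟩ := this
    exact ⟨t, ht, ht.isNormal h hp hv hz hgb⟩
  obtain ⟨h1, h2, h3, h4⟩ := h
  have hgm := s.val_le g
  have hzm := s.pos_le z
  -- Five rotations alternate between top and bottom. First `g` is brought to the top end, so that
  -- the bottom points to its left can be rotated.
  obtain ⟨s1, t1, p1, v1⟩ := s.exists_rotate_val_last (o := o) (y := g) h1 (by omega)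
  simp only [h2] at v1
  have a1 := v1 g; have a2 := v1 z; have a3 := v1 b; have a4 := v1 o
  rw [if_neg (by omega), if_pos (by omega)] at a1 a2 a3
  rw [if_pos (by omega)] at a4
  -- With `b` first at the bottom, `o` stands directly to the left of `g`.
  obtain ⟨s2, t2, v2, p2⟩ := s1.exists_rotate_pos (w := g) (x := b) (by omega)
    (by rw [p1, p1]; omega)
  simp only [p1] at p2
  have b1 := p2 b; have b2 := p2 o; have b3 := p2 z; have b4 := p2 g
  rw [if_neg (by omega), if_pos (by omega)] at b1
  rw [if_neg (by omega), if_neg (by omega)] at b2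
  rw [if_pos (by omega)] at b3 b4
  -- Now `b` is the first edge, and the top rotation at `b` brings `z` to the end.
  obtain ⟨s3, t3, p3, v3⟩ := s2.exists_rotate_val_last (o := b) (y := z) (by omega)
    (by rw [v2, v2]; omega)
  simp only [v2, a3, a2] at v3
  have w3 : ∀ e, s3.val e = if s.val e = 0 then 0 else if s.val e = 1 then 1 + m - s.val g else
      if s.val e ≤ s.val z then s.val e + m - s.val z else
      if s.val e ≤ s.val g then 1 + m - s.val g + s.val e - s.val z else s.val e - s.val g := by
    intro e
    have he := v1 e
    have := v3 e
    have := s.val_le e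
    generalize s.val e = x at *
    generalize s1.val e = x1 at *
    split_ifs <;> split_ifs at he <;> split_ifs at this <;> omega
  have c1 : s3.val z = m := by rw [w3]; split_ifs <;> omega
  have c2 : s3.val o = 0 := by rw [w3, if_pos h2]
  have c3 : s3.val g = 1 + m - s.val z := by rw [w3]; split_ifs <;> omega
  -- Bringing `o` back to the front puts `g` in second place and moves the block that began with `b`
  -- in front of `z`.
  obtain ⟨s4, t4, v4, p4⟩ := s3.exists_rotate_pos (w := z) (x := o) (by omega)
    (by rw [p3, p3]; omega)
  simp only [p3, b2, b3] at p4
  have d1 := p4 o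
  rw [if_neg (by omega), if_pos (by omega)] at d1
  obtain ⟨s5, t5, p5, v5⟩ := s4.exists_rotate_val_first (o := o) (y := g) (by omega)
    (by rw [v4, v4]; omega)
  simp only [v4, c2, c3] at v5
  refine ⟨s5, t1.trans (t2.trans (t3.trans (t4.trans t5))), fun e => ?_, fun e => ?_⟩
  · have e2 := p2 e
    have e4 := p4 e
    rw [p5]
    have := s.pos_le e
    generalize s.pos e = x at *
    generalize s2.pos e = x2 at *
    split_ifs <;> split_ifs at e2 <;> split_ifs at e4 <;> omega
  · have e3 := w3 e
    have e5 := v5 e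
    have := s.val_le e
    generalize s.val e = x at *
    generalize s3.val e = x3 at *
    split_ifs <;> split_ifs at e3 <;> split_ifs at e5 <;> omega

end Labelled
end Rauzy

/-! ### Standard permutations in irreducible classes -/

namespace Rauzy
open Equiv

theorem Labelled.exists_perm_eq {m : ℕ} (σ : Perm (Fin (m + 1))) :
    ∃ s : Labelled m, s.perm = σ ∧ (∀ e, s.pos e = e) ∧ ∀ e, s.val e = σ e :=
  ⟨(1, σ), by simp [perm], fun _ => rfl, fun _ => rfl⟩

theorem mem_iff_lt_card_of_isLowerSet {n : ℕ} {S : Finset (Fin n)}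
    (h : ∀ i ∈ S, ∀ j < i, j ∈ S) (i : Fin n) : i ∈ S ↔ (i : ℕ) < S.card := by
  constructor
  · intro hi
    have : Finset.Iic i ⊆ S := fun j hj => by
      rcases (Finset.mem_Iic.1 hj).lt_or_eq with hlt | rfl
      exacts [h i hi j hlt, hi]
    have := Finset.card_le_card this
    rw [Fin.card_Iic] at this
    omega
  · intro hi
    by_contra hn
    have : S ⊆ Finset.Iio i := fun j hj => by
      rw [Finset.mem_Iio]
      by_contra hij
      rcases (not_lt.1 hij).lt_or_eq with hlt | rfl
      exacts [hn (h j hj i hlt), hn hj]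
    have := Finset.card_le_card this
    rw [Fin.card_Iio] at this
    omega

/-- Every irreducible class contains a permutation with `σ 1 = 1`. -/
theorem IsIrreducible.exists_standard {m : ℕ} {σ : Perm (Fin (m + 1))} (hσ : IsIrreducible σ) :
    ∃ τ, Connected σ τ ∧ τ 0 = 0 := by
  obtain ⟨τ, hτ, hmin⟩ := Set.exists_min_image (classOf σ) (fun τ => (τ 0 : ℕ)) (Set.toFinite _)
    ⟨σ, Connected.refl σ⟩
  refine ⟨τ, hτ, ?_⟩
  by_contra h0
  have h0 : 0 < (τ 0 : ℕ) := Nat.pos_of_ne_zero fun h => h0 (Fin.ext h)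
  -- Otherwise `y` could be rotated to the top end and then `x` to the bottom front, which gives a
  -- smaller first value.
  have key : ∀ x y, (τ x : ℕ) < τ 0 → (τ 0 : ℕ) < τ y → y < x := by
    intro x y hx hy
    by_contra hyx
    have hxy : x < y := lt_of_le_of_ne (not_lt.1 hyx) (by rintro rfl; omega)
    obtain ⟨r, hr, hp, hv⟩ := Labelled.exists_perm_eq τ
    obtain ⟨s, h1, h2, h3⟩ := r.exists_rotate_val_last (o := 0) (y := y) (by simp [hp])
      (by rw [hv, hv]; exact hy)
    simp only [hp, hv] at h2 h3
    have hym := (τ y).is_le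
    have hsy : s.val y = m := by rw [h3]; split_ifs <;> omega
    obtain ⟨t, h4, h5, h6⟩ := s.exists_rotate_pos (w := y) (x := x) hsy
      (by rw [h2, h2]; exact hxy)
    have ht : (t.perm 0 : ℕ) = τ x := by
      rw [t.perm_val (e := x), h5, h3, if_pos hx.le]
      rw [h6, h2, h2, if_neg (by have : (x : ℕ) < y := hxy; omega), if_pos le_rfl]
      simp
    have := hmin t.perm (hτ.trans (hr ▸ (h1.trans h4).connected))
    omega
  -- By `key`, the edges whose value is at least that of the first one form an initial segment at
  -- the bottom. As `τ 0` is positive, this is a reducing block.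
  refine (not_isIrreducible_iff τ).2 ⟨m + 1 - τ 0, by omega, by omega, fun i => ?_⟩
    (hσ.of_connected hτ)
  have hcard : (Finset.univ.filter fun i => τ 0 ≤ τ i).card = m + 1 - τ 0 := by
    rw [← Fin.card_Ici, ← Finset.card_map τ.toEmbedding]
    congr 1
    ext j
    simp only [Finset.mem_map, Finset.mem_filter, Finset.mem_univ, true_and, Finset.mem_Ici]
    exact ⟨by rintro ⟨i, hi, rfl⟩; exact hi, fun h => ⟨τ.symm j, by simpa using h, by simp⟩⟩
  have := mem_iff_lt_card_of_isLowerSet (S := Finset.univ.filter fun i => τ 0 ≤ τ i) (by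
    simp only [Finset.mem_filter, Finset.mem_univ, true_and]
    intro i hi j hji
    by_contra hj
    rcases hi.lt_or_eq with hlt | heq
    · exact absurd (key j i (not_le.1 hj) hlt) hji.asymm
    · rw [← τ.injective heq] at hji
      exact absurd hji (by simp)) i
  rw [hcard] at this
  simp only [Finset.mem_filter, Finset.mem_univ, true_and, Fin.le_def] at this
  omega

end Rauzy

/-! ### The order of the edges on the rank path -/

namespace Rauzy
open Equiv
namespace Labelled
variable {m : ℕ}

/-- The edge `e'` follows the edge `e` on the path through the diagram: one goes from the bottom
endpoint of `e` to its right neighbour, along that edge to the top, and then again to the right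
neighbour, passing through the mark if necessary. -/
def Follows (s : Labelled m) (e e' : Fin (m + 1)) : Prop :=
  ∃ x, s.pos x = s.pos e + 1 ∧ (s.val e' = s.val x + 1 ∨
    s.val x = m ∧ ∃ o, s.pos o = 0 ∧ s.val e' = s.val o + 1)

/-- The cyclic order of the top points to the right of the first edge is kept; only the place of the
cut changes. Thus a direct step into the old last point becomes a step through the mark, and the old
step through the mark becomes direct. -/
theorem Follows.stepL {s : Labelled m} {e e' : Fin (m + 1)} (h : s.Follows e e') :
    s.stepL.Follows e e' := by
  obtain ⟨x, hx, h⟩ := h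
  refine ⟨x, hx, ?_⟩
  obtain ⟨o, ho⟩ := s.exists_pos_eq (k := 0) (Nat.zero_le _)
  have h1 := s.val_stepL ho x
  have h2 := s.val_stepL ho e'
  have h3 := s.val_stepL ho o
  have hxo : s.val x ≠ s.val o := by
    rw [Ne, s.val_inj, ← s.pos_inj]; omega
  have hxm := s.val_le x
  have hem := s.val_le e'
  rw [if_pos le_rfl] at h3
  rcases h with h | ⟨h, o', ho', h'⟩
  · by_cases hm : s.val e' = m ∧ s.val o < s.val x
    · refine Or.inr ⟨?_, o, ho, ?_⟩
      · rw [h1]; split_ifs <;> omega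
      · rw [h2, h3]; split_ifs <;> omega
    · left
      rw [h1, h2]; split_ifs <;> omega
  · rw [s.pos_inj.1 (ho'.trans ho.symm)] at h'
    by_cases hm : s.val e' = m
    · exact Or.inr ⟨by rw [h1]; split_ifs <;> omega, o, ho, by rw [h2, h3]; split_ifs <;> omega⟩
    · left
      rw [h1, h2]; split_ifs <;> omega

theorem Follows.stepR {s : Labelled m} {e e' : Fin (m + 1)} (h : s.Follows e e') :
    s.stepR.Follows e e' := by
  obtain ⟨x, hx, h⟩ := h
  obtain ⟨w, hw⟩ := s.exists_val_eq (k := m) le_rfl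
  obtain ⟨o, ho⟩ := s.exists_pos_eq (k := 0) (Nat.zero_le _)
  have hpos := s.pos_stepR hw
  by_cases hwo : s.pos w = 0
  · have hid : ∀ e, s.stepR.pos e = s.pos e := fun e => by rw [hpos, if_pos (by omega)]
    simp only [Follows, hid, val_stepR]
    exact ⟨x, hx, h⟩
  have hvw : ∀ y, s.val y = m → y = w := fun y hy => s.val_inj.1 (hy.trans hw.symm)
  have hvo : ∀ y, s.pos y = 0 → y = o := fun y hy => s.pos_inj.1 (hy.trans ho.symm)
  have he := hpos e
  have hxp := hpos x
  have hop := hpos o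
  have hwp := hpos w
  rw [if_pos le_rfl] at hwp
  rw [if_neg (by omega), if_pos ho] at hop
  rcases lt_trichotomy (s.pos e + 1) (s.pos w) with hlt | heq | hgt
  -- The first edge is moved directly to the left of `w`, so its path now goes up along `w` and
  -- through the mark to the new first edge, its former neighbour.
  · by_cases h0 : s.pos e = 0
    · obtain ⟨n, hn⟩ := s.stepR.exists_pos_eq (k := 0) (Nat.zero_le _)
      have hnx : n = x := by
        rw [← s.stepR.pos_inj, hn, hxp, if_neg (by omega), if_neg (by omega)]; omega
      subst hnx
      refine ⟨w, by rw [he, hwp, if_neg (by omega), if_pos h0, Nat.sub_add_cancel (by omega)], Or.inr ⟨hw, n, hn, ?_⟩⟩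
      rcases h with h | ⟨h, _⟩
      · exact h
      · rw [hvw _ h] at hx; omega
    · refine ⟨x, by rw [he, hxp]; split_ifs <;> omega, ?_⟩
      rcases h with h | ⟨h, _⟩
      · exact Or.inl h
      · rw [hvw _ h] at hx; omega
  -- The path from `e` used to go up along `w` and through the mark; now the old first edge stands
  -- between `e` and `w` and gives the direct step.
  · have hxw : x = w := s.pos_inj.1 (by omega)
    subst hxw
    rcases h with h | ⟨_, o', ho', h⟩
    · have := s.val_le e'; omega
    · rw [hvo _ ho'] at h
      by_cases h0 : s.pos e = 0
      · have := hvo _ h0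
        subst this
        obtain ⟨n, hn⟩ := s.stepR.exists_pos_eq (k := 0) (Nat.zero_le _)
        have : n = e := by rw [← s.stepR.pos_inj, hn, hop]; omega
        subst this
        exact ⟨x, by omega, Or.inr ⟨hw, n, hn, h⟩⟩
      · exact ⟨o, by rw [he, hop, if_neg (by omega), if_neg h0]; omega, Or.inl h⟩
  · refine ⟨x, by rw [he, hxp, if_pos (by omega), if_pos (by omega), hx], ?_⟩
    rcases h with h | ⟨h, _⟩
    · exact Or.inl h
    · rw [hvw _ h] at hx; omega

theorem Follows.of_tracks {s t : Labelled m} {e e' : Fin (m + 1)} (h : s.Follows e e')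
    (hst : Tracks s t) : t.Follows e e' := by
  induction hst with
  | refl => exact h
  | tail _ h ih =>
    rcases h with rfl | rfl
    exacts [ih.stepL, ih.stepR]

/-- `R` moves an edge only to positions strictly to the left of another edge, never to the last one.
The edge in last position is the one where the rank path ends. -/
theorem pos_ne_last_of_tracks {s t : Labelled m} {e : Fin (m + 1)} (h : s.pos e ≠ m)
    (hst : Tracks s t) : t.pos e ≠ m := by
  induction hst with
  | refl => exact h
  | @tail a b _ h ih =>
    rcases h with rfl | rfl
    · exact ih
    · obtain ⟨w, hw⟩ := a.exists_val_eq (k := m) le_rfl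
      rw [a.pos_stepR hw]
      have := a.pos_le e
      have := a.pos_le w
      split_ifs <;> omega

end Labelled
end Rauzy

/-! ### Trapped states are the identity -/

namespace Rauzy
open Equiv
namespace Labelled
variable {m : ℕ}

theorem not_descent {s : Labelled m} (h : IsPrimitive s.perm) {g z : Fin (m + 1)}
    (hp : s.pos z = s.pos g + 1) (hv : s.val g = s.val z + 1) : False := by
  have hz := s.pos_le z
  refine (h ⟨s.pos g, by omega⟩).1 ?_
  rw [IsDescent, s.perm_val (e := z) (by simp [hp]), s.perm_val (e := g) (by simp), hv]

/-- From `s` one never reaches a state whose first edges are `o` and `f`, where `f` is the second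
edge after `o` on the rank path. -/
structure Trapped (s : Labelled m) (o t f : Fin (m + 1)) : Prop where
  follows_fst : s.Follows o t
  follows_snd : s.Follows t f
  pos_ne : s.pos f ≠ m
  primitive : ∀ u, Tracks s u → IsPrimitive u.perm
  ne_of_isNormal : ∀ u, Tracks s u → ∀ b, u.IsNormal o b → b ≠ f

namespace Trapped

variable {s : Labelled m} {o t f b : Fin (m + 1)}

theorem of_tracks (h : s.Trapped o t f) {u : Labelled m} (hu : Tracks s u) : u.Trapped o t f :=
  ⟨h.1.of_tracks hu, h.2.of_tracks hu, pos_ne_last_of_tracks h.3 hu,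
    fun w hw => h.4 w (hu.trans hw), fun w hw => h.5 w (hu.trans hw)⟩

theorem val_snd (h : s.Trapped o t f) (hb : s.IsNormal o b) : s.val t = 2 := by
  obtain ⟨h1, h2, h3, h4⟩ := hb
  obtain ⟨x, hx, h⟩ := id h.follows_fst
  have hxb : x = b := s.pos_inj.1 (by omega)
  subst hxb
  rcases h with h | ⟨hm, o', ho', h⟩
  · omega
  -- A passage through the mark would force `m = 1` and `t = b`, and then `t` has no right
  -- neighbour.
  · have ho : o' = o := s.pos_inj.1 (by omega)
    subst ho
    have ht : t = x := s.val_inj.1 (by omega)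
    subst ht
    obtain ⟨y, hy, -⟩ := h.follows_snd
    have := s.pos_le y
    omega

theorem ne_snd (h : s.Trapped o t f) (hb : s.IsNormal o b) : b ≠ f :=
  h.ne_of_isNormal s (.refl s) b hb

theorem one_lt_pos (_ : s.Trapped o t f) (hb : s.IsNormal o b) {e : Fin (m + 1)}
    (he : 1 < s.val e) : 1 < s.pos e := by
  obtain ⟨h1, h2, h3, h4⟩ := hb
  by_contra hlt
  have : s.pos e = s.pos o ∨ s.pos e = s.pos b := by omega
  rcases this with h | h <;> rw [s.pos_inj] at h <;> subst h <;> omega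

theorem one_lt_val (_ : s.Trapped o t f) (hb : s.IsNormal o b) {e : Fin (m + 1)}
    (he : 1 < s.pos e) : 1 < s.val e := by
  obtain ⟨h1, h2, h3, h4⟩ := hb
  by_contra hlt
  have : s.val e = s.val o ∨ s.val e = s.val b := by omega
  rcases this with h | h <;> rw [s.val_inj] at h <;> subst h <;> omega

/-- A step from `t` through the mark would lead to the top point next to that of `o`, which belongs
to `b`, and `b = f` is forbidden. So the step is direct. -/
theorem exists_next (h : s.Trapped o t f) (hb : s.IsNormal o b) :
    ∃ x, s.pos x = s.pos t + 1 ∧ s.val f = s.val x + 1 ∧ 3 ≤ s.val x := by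
  have ht := h.val_snd hb
  have htp := h.one_lt_pos hb (e := t) (by omega)
  obtain ⟨x, hx, hf⟩ := h.follows_snd
  have hxv := h.one_lt_val hb (e := x) (by omega)
  have hxt : s.val x ≠ s.val t := by
    rw [Ne, s.val_inj]; rintro rfl; omega
  refine ⟨x, hx, ?_, by omega⟩
  rcases hf with hf | ⟨-, o', ho', hf⟩
  · exact hf
  · refine absurd (s.val_inj.1 ?_) (h.ne_snd hb)
    rw [hf, hb.val_snd, s.pos_inj.1 (ho'.trans hb.pos_fst.symm), hb.val_fst]

theorem exists_right (h : s.Trapped o t f) : ∃ r, s.pos f < s.pos r := by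
  have h1 := h.pos_ne
  have h2 := s.pos_le f
  obtain ⟨r, hr⟩ := s.exists_pos_eq (k := s.pos f + 1) (by omega)
  exact ⟨r, by omega⟩

/-- All edges that begin to the right of `f` cross no edge `f`. -/
theorem val_lt (h : s.Trapped o t f) (hb : s.IsNormal o b) {z : Fin (m + 1)}
    (hz : s.pos f < s.pos z) : s.val f < s.val z := by
  by_contra hlt
  have hne : s.val f ≠ s.val z := by rw [Ne, s.val_inj]; rintro rfl; omega
  obtain ⟨x, -, hx, hx'⟩ := h.exists_next hb
  have hfp := h.one_lt_pos hb (e := f) (by omega)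
  -- If `z` crossed `f`, the exchange of this pair would make `f` the second edge.
  obtain ⟨u, hu, hu'⟩ := hb.exists_exchange hz (by omega) (h.one_lt_val hb (by omega))
  exact h.ne_of_isNormal u hu.tracks f hu' rfl

/-- The exchange of `g` and `z` moves `u` past `f` to the right and keeps both top ends, since these
lie at or below that of `z`. Then `u` starts to the right of `f` and ends below it, against
`val_lt`. -/
theorem not_spanning (h : s.Trapped o t f) (hb : s.IsNormal o b) {g z u : Fin (m + 1)}
    (h1 : s.pos g < s.pos f) (h2 : s.pos f < s.pos z) (h3 : s.val z < s.val g)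
    (h4 : 1 < s.val u) (h5 : s.val u < s.val f) (h6 : s.pos u < s.pos g) : False := by
  have hz := h.val_lt hb h2
  obtain ⟨w, hw, hn⟩ := hb.exists_exchange (h1.trans h2) h3 (by omega)
  have hu := h.one_lt_pos hb h4
  have h7 := h.one_lt_pos hb (e := f) (by omega)
  have key := (h.of_tracks hw.tracks).val_lt hn (z := u)
  have e1 := hw.pos_eq f
  have e2 := hw.pos_eq u
  have e3 := hw.val_eq f
  have e4 := hw.val_eq u
  rw [if_neg (by omega), if_neg (by omega), if_pos h2] at e1
  rw [if_neg (by omega), if_pos h6] at e2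
  rw [if_neg (by omega), if_neg (by omega), if_pos (by omega)] at e3 e4
  omega

/-- The exchange of `g` and `z` fixes the bottom ends of `f` and `u`, but interchanges the top block
between `z` and `g`, which contains `f`, with the one above `g`, which contains `u`. Then `u`
crosses `f` from the right. -/
theorem not_enclosing (h : s.Trapped o t f) (hb : s.IsNormal o b) {g z u : Fin (m + 1)}
    (h1 : s.pos g < s.pos z) (h2 : s.pos z < s.pos f) (h3 : 1 < s.val z) (h4 : s.val z < s.val f)
    (h5 : s.val f < s.val g) (h6 : s.pos f < s.pos u) (h7 : s.val g < s.val u) : False := by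
  obtain ⟨w, hw, hn⟩ := hb.exists_exchange h1 (h4.trans h5) h3
  have key := (h.of_tracks hw.tracks).val_lt hn (z := u)
  have := s.val_le u
  have e1 := hw.pos_eq f
  have e2 := hw.pos_eq u
  have e3 := hw.val_eq f
  have e4 := hw.val_eq u
  rw [if_neg (by omega), if_neg (by omega), if_neg (by omega)] at e1 e2
  rw [if_neg (by omega), if_neg (by omega), if_neg (by omega), if_pos h5] at e3
  rw [if_neg (by omega), if_neg (by omega), if_neg (by omega), if_neg (by omega),
    if_neg (by omega)] at e4
  omega

/-- An edge above `f` that begins to the left of `f` cannot begin between two edges below `f`. -/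
theorem not_between (h : s.Trapped o t f) (hb : s.IsNormal o b) {u g z : Fin (m + 1)}
    (h1 : s.val f < s.val u) (h2 : s.pos g < s.pos u) (h3 : s.pos u < s.pos z)
    (h4 : s.pos z < s.pos f) (h5 : 1 < s.val g) (h6 : s.val g < s.val f) (h7 : 1 < s.val z)
    (h8 : s.val z < s.val f) : False := by
  obtain ⟨r, hr⟩ := h.exists_right
  have hne : s.val r ≠ s.val u := by rw [Ne, s.val_inj]; rintro rfl; omega
  -- An edge `r` to the right of `f` either crosses `u` or ends above it; the two cases are the two
  -- forbidden patterns.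
  rcases lt_or_gt_of_ne hne with hlt | hgt
  · exact h.not_spanning hb (by omega) hr hlt h5 h6 h2
  · exact h.not_enclosing hb h3 h4 h7 h8 h1 hr hgt

/-- The edges below `f`, except for the first two, do not cross. -/
theorem low_increasing (h : s.Trapped o t f) (hb : s.IsNormal o b) {g z : Fin (m + 1)}
    (h1 : 1 < s.val z) (h2 : s.val z < s.val g) (h3 : s.val g < s.val f)
    (h4 : s.pos g < s.pos z) : False := by
  have low : ∀ e, s.val e < s.val f → s.pos e < s.pos f := by
    intro e he
    by_contra hle
    have hne : s.pos e ≠ s.pos f := by rw [Ne, s.pos_inj]; rintro rfl; omega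
    have := h.val_lt hb (z := e) (by omega)
    omega
  -- Induction on the distance of the top ends reduces the claim to neighbouring top ends. Then
  -- primitivity forbids neighbouring bottom ends, and some `u` starts right after `g`.
  obtain ⟨d, hd⟩ : ∃ d, s.val g ≤ s.val z + 1 + d := ⟨s.val g, by omega⟩
  induction d generalizing g z with
  | zero =>
    have hgap : s.val g = s.val z + 1 := by omega
    by_cases hadj : s.pos z = s.pos g + 1
    · exact not_descent (h.primitive s (.refl s)) hadj hgap
    have hzm := s.pos_le z
    have hzf := low z (by omega)
    obtain ⟨u, hu⟩ := s.exists_pos_eq (k := s.pos g + 1) (by omega)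
    have hgp := h.one_lt_pos hb (e := g) (by omega)
    have huv := h.one_lt_val hb (e := u) (by omega)
    have huf : s.val u ≠ s.val f := by rw [Ne, s.val_inj]; rintro rfl; omega
    have hug : s.val u ≠ s.val g := by rw [Ne, s.val_inj]; rintro rfl; omega
    have huz : s.val u ≠ s.val z := by rw [Ne, s.val_inj]; rintro rfl; omega
    rcases lt_or_gt_of_ne huf with hlt | hgt
    -- As the top ends are neighbours, the exchange sends `b` to the very last top point. Hence `b`
    -- crosses `r`, while `u`, now third at the bottom, starts to the left of `b` and stays below
    -- `f`.
    · obtain ⟨w, hw, hn⟩ := hb.exists_exchange h4 h2 h1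
      obtain ⟨r, hr⟩ := h.exists_right
      have hrv := h.val_lt hb hr
      have hrm := s.val_le r
      obtain ⟨-, -, b3, b4⟩ := hb
      have p1 := hw.pos_eq b
      have p2 := hw.pos_eq f
      have p3 := hw.pos_eq r
      have p4 := hw.pos_eq u
      have v1 := hw.val_eq b
      have v2 := hw.val_eq f
      have v3 := hw.val_eq r
      have v4 := hw.val_eq u
      rw [if_neg (by omega), if_pos (by omega)] at p1
      rw [if_neg (by omega), if_neg (by omega), if_neg (by omega)] at p2 p3
      rw [if_neg (by omega), if_neg (by omega), if_pos (by omega)] at p4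
      rw [if_neg (by omega), if_pos (by omega)] at v1
      rw [if_neg (by omega), if_neg (by omega), if_neg (by omega), if_neg (by omega),
        if_neg (by omega)] at v2 v3
      have hur : 1 < w.val u ∧ w.val u < w.val f := by
        rw [v2, v4]; split_ifs <;> omega
      exact (h.of_tracks hw.tracks).not_spanning hn (g := b) (z := r) (u := u) (by omega)
        (by omega) (by omega) hur.1 hur.2 (by omega)
    · exact h.not_between hb hgt (g := g) (z := z) (by omega) (by omega) hzf (by omega) h3 h1
        (by omega)
  | succ d ih =>
    by_cases hgap : s.val g = s.val z + 1
    · exact ih h1 h2 h3 h4 (by omega)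
    have hgm := s.val_le g
    -- The edge `w` just above `z` at the top crosses `z` or `g`, and both pairs are closer.
    obtain ⟨w, hw⟩ := s.exists_val_eq (k := s.val z + 1) (by omega)
    have hwz : s.pos w ≠ s.pos z := by rw [Ne, s.pos_inj]; rintro rfl; omega
    rcases lt_or_gt_of_ne hwz with hlt | hgt
    · exact ih h1 (by omega) (by omega) hlt (by omega)
    · exact ih (g := g) (z := w) (by omega) (by omega) h3 (by omega) (by omega)

/-- At the bottom `t` is directly followed by the edge `x` whose top end is just below that of `f`.
An edge with top end `3` other than `x` would cross `t` or `x`, and all of them lie below `f`. -/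
theorem val_eq_four (h : s.Trapped o t f) (hb : s.IsNormal o b) : s.val f = 4 := by
  obtain ⟨x, hx, hf, hx3⟩ := h.exists_next hb
  have ht := h.val_snd hb
  by_contra hne
  have hfm := s.val_le f
  obtain ⟨w, hw⟩ := s.exists_val_eq (k := 3) (by omega)
  have hwx : s.pos w ≠ s.pos x := by rw [Ne, s.pos_inj]; rintro rfl; omega
  have hwt : s.pos w ≠ s.pos t := by rw [Ne, s.pos_inj]; rintro rfl; omega
  rcases lt_or_gt_of_ne hwt with hlt | hgt
  · exact h.low_increasing hb (g := w) (z := t) (by omega) (by omega) (by omega) hlt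
  · exact h.low_increasing hb (g := x) (z := w) (by omega) (by omega) (by omega) (by omega)

theorem pos_snd_lt (h : s.Trapped o t f) (hb : s.IsNormal o b) : s.pos t < s.pos f := by
  by_contra hle
  have ht := h.val_snd hb
  have hf := h.val_eq_four hb
  have hne : s.pos t ≠ s.pos f := by rw [Ne, s.pos_inj]; rintro rfl; omega
  have := h.val_lt hb (z := t) (by omega)
  omega

/-- The edges that begin to the right of `f` do not cross. -/
theorem right_increasing (h : s.Trapped o t f) (hb : s.IsNormal o b) {g z : Fin (m + 1)}
    (h1 : s.pos f < s.pos g) (h2 : s.pos g < s.pos z) (h3 : s.val z < s.val g) : False := by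
  have ht := h.val_snd hb
  have htf := h.pos_snd_lt hb
  have hf := h.val_eq_four hb
  have htp := h.one_lt_pos hb (e := t) (by omega)
  obtain ⟨-, -, b3, b4⟩ := id hb
  obtain ⟨d, hd⟩ : ∃ d, s.val g ≤ s.val z + 1 + d := ⟨s.val g, by omega⟩
  induction d generalizing g z with
  | zero =>
    have hgap : s.val g = s.val z + 1 := by omega
    by_cases hadj : s.pos z = s.pos g + 1
    · exact not_descent (h.primitive s (.refl s)) hadj hgap
    have hzm := s.pos_le z
    obtain ⟨u, hu⟩ := s.exists_pos_eq (k := s.pos g + 1) (by omega)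
    have huv := h.val_lt hb (z := u) (by omega)
    have hzv := h.val_lt hb (z := z) (by omega)
    have hum := s.val_le u
    have hug : s.val u ≠ s.val g := by rw [Ne, s.val_inj]; rintro rfl; omega
    have huz : s.val u ≠ s.val z := by rw [Ne, s.val_inj]; rintro rfl; omega
    rcases lt_or_gt_of_ne huz with hlt | hgt
    -- After this exchange `u` is third at the bottom, to the left of `t` and `f`, and its top end
    -- lies between those of `f` and `z`. So `u`, `t`, `z` enclose `f`.
    · obtain ⟨w, hw, hn⟩ := hb.exists_exchange h2 h3 (by omega)
      have p1 := hw.pos_eq u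
      have p2 := hw.pos_eq f
      have p3 := hw.pos_eq t
      have p4 := hw.pos_eq z
      have v1 := hw.val_eq u
      have v2 := hw.val_eq f
      have v3 := hw.val_eq t
      have v4 := hw.val_eq z
      rw [if_neg (by omega), if_neg (by omega), if_pos (by omega)] at p1
      rw [if_neg (by omega), if_pos (by omega)] at p2 p3
      rw [if_neg (by omega), if_neg (by omega), if_neg (by omega)] at p4
      rw [if_neg (by omega), if_neg (by omega), if_pos (by omega)] at v1 v2 v3 v4
      exact (h.of_tracks hw.tracks).not_enclosing hn (g := u) (z := t) (u := z) (by omega)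
        (by omega) (by omega) (by omega) (by omega) (by omega) (by omega)
    -- Here `u` ends above `g`. The exchange of `u` and `z` keeps the bottom order `b`, `t`, `f`,
    -- `g` and lifts `b` above `f` but below `g`, so `b`, `t`, `g` enclose `f`.
    · obtain ⟨w, hw, hn⟩ := hb.exists_exchange (g := u) (z := z) (by omega) (by omega) (by omega)
      have p1 := hw.pos_eq b
      have p2 := hw.pos_eq f
      have p3 := hw.pos_eq t
      have p4 := hw.pos_eq g
      have v1 := hw.val_eq b
      have v2 := hw.val_eq f
      have v3 := hw.val_eq t
      have v4 := hw.val_eq g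
      rw [if_neg (by omega), if_pos (by omega)] at p1 p2 p3 p4
      rw [if_neg (by omega), if_pos (by omega)] at v1
      rw [if_neg (by omega), if_neg (by omega), if_pos (by omega)] at v2 v3
      rw [if_neg (by omega), if_neg (by omega), if_neg (by omega), if_pos (by omega)] at v4
      exact (h.of_tracks hw.tracks).not_enclosing hn (g := b) (z := t) (u := g) (by omega)
        (by omega) (by omega) (by omega) (by omega) (by omega) (by omega)
  | succ d ih =>
    by_cases hgap : s.val g = s.val z + 1
    · exact ih h1 h2 h3 (by omega)
    have hgm := s.val_le g
    have hzv := h.val_lt hb (z := z) (by omega)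
    obtain ⟨w, hw⟩ := s.exists_val_eq (k := s.val z + 1) (by omega)
    have hwz : s.pos w ≠ s.pos z := by rw [Ne, s.pos_inj]; rintro rfl; omega
    have hwf : s.pos w ≠ s.pos f := by rw [Ne, s.pos_inj]; rintro rfl; omega
    have hwt : s.pos w ≠ s.pos t := by rw [Ne, s.pos_inj]; rintro rfl; omega
    -- The induction needs `w` to the right of `f`; the two other places, separated by `t`, give
    -- forbidden patterns.
    rcases lt_or_gt_of_ne hwf with hlt | hgt
    · rcases lt_or_gt_of_ne hwt with hlt' | hgt'
      · exact h.not_enclosing hb (g := w) (z := t) (u := g) hlt' htf (by omega) (by omega)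
          (by omega) h1 (by omega)
      · exact h.not_spanning hb (g := w) (z := z) (u := t) hlt (by omega) (by omega) (by omega)
          (by omega) hgt'
    · rcases lt_or_gt_of_ne hwz with hlt' | hgt'
      · exact ih hgt hlt' (by omega) (by omega)
      · exact ih (g := g) (z := w) h1 (by omega) (by omega) (by omega)

/-- No edge that begins to the left of `f` crosses one that begins to the right of `f`. -/
theorem val_lt_of_pos_lt (h : s.Trapped o t f) (hb : s.IsNormal o b) {g z : Fin (m + 1)}
    (h1 : s.pos g < s.pos f) (h2 : s.pos f < s.pos z) (h3 : s.val z < s.val g) : False := by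
  have hf := h.val_eq_four hb
  have hz := h.val_lt hb h2
  have hfp := h.one_lt_pos hb (e := f) (by omega)
  have hgp := h.one_lt_pos hb (e := g) (by omega)
  have hgm := s.val_le g
  -- The exchange moves `b` between `f` and `z` at the bottom and above `z` at the top: a crossing
  -- to the right of `f`.
  obtain ⟨w, hw, hn⟩ := hb.exists_exchange (h1.trans h2) h3 (by omega)
  obtain ⟨-, -, b3, b4⟩ := id hb
  have p1 := hw.pos_eq b
  have p2 := hw.pos_eq f
  have p3 := hw.pos_eq z
  have v1 := hw.val_eq b
  have v3 := hw.val_eq z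
  rw [if_neg (by omega), if_pos (by omega)] at p1
  rw [if_neg (by omega), if_neg (by omega), if_pos (by omega)] at p2
  rw [if_neg (by omega), if_neg (by omega), if_neg (by omega)] at p3
  rw [if_neg (by omega), if_pos (by omega)] at v1
  rw [if_neg (by omega), if_neg (by omega), if_pos (by omega)] at v3
  exact (h.of_tracks hw.tracks).right_increasing hn (g := b) (z := z) (by omega) (by omega)
    (by omega)

/-- No edge that begins to the left of `f` crosses `f`. -/
theorem left_val_lt (h : s.Trapped o t f) (hb : s.IsNormal o b) {g : Fin (m + 1)}
    (h1 : s.pos g < s.pos f) : s.val g < s.val f := by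
  by_contra hlt
  have hne : s.val g ≠ s.val f := by rw [Ne, s.val_inj]; rintro rfl; omega
  have hf := h.val_eq_four hb
  have hgm := s.val_le g
  obtain ⟨r, hr⟩ := h.exists_right
  have hgr : s.val g ≠ s.val r := by rw [Ne, s.val_inj]; rintro rfl; omega
  have hgr' : s.val g < s.val r := by
    by_contra hle
    exact h.val_lt_of_pos_lt hb h1 hr (by omega)
  have hrm := s.val_le r
  have hgp := h.one_lt_pos hb (e := g) (by omega)
  -- The exchange of `g` and `f` leaves `b` to the left of `f` and lifts its top end above that of
  -- `r`, so `b` crosses an edge to the right of `f`.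
  obtain ⟨w, hw, hn⟩ := hb.exists_exchange h1 (by omega) (by omega)
  obtain ⟨-, -, b3, b4⟩ := id hb
  have p1 := hw.pos_eq b
  have p2 := hw.pos_eq f
  have p3 := hw.pos_eq r
  have v1 := hw.val_eq b
  have v3 := hw.val_eq r
  rw [if_neg (by omega), if_pos (by omega)] at p1
  rw [if_neg (by omega), if_neg (by omega), if_neg (by omega)] at p2 p3
  rw [if_neg (by omega), if_pos (by omega)] at v1
  rw [if_neg (by omega), if_neg (by omega), if_neg (by omega), if_neg (by omega),
    if_neg (by omega)] at v3
  exact (h.of_tracks hw.tracks).val_lt_of_pos_lt hn (g := b) (z := r) (by omega) (by omega)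
    (by omega)

theorem monotone (h : s.Trapped o t f) (hb : s.IsNormal o b) {e e' : Fin (m + 1)}
    (he : s.pos e < s.pos e') : s.val e < s.val e' := by
  by_contra hlt
  have hne : s.val e ≠ s.val e' := by rw [Ne, s.val_inj]; rintro rfl; omega
  obtain ⟨b1, b2, b3, b4⟩ := id hb
  have hf := h.val_eq_four hb
  have he0 : 1 < s.pos e := by
    by_contra hle
    have : s.pos e = s.pos o ∨ s.pos e = s.pos b := by omega
    rcases this with h' | h' <;> rw [s.pos_inj] at h' <;> subst h'
    · omega
    · have := h.one_lt_val hb (e := e') (by omega)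
      omega
  have hv' := h.one_lt_val hb (e := e') (by omega)
  rcases lt_trichotomy (s.pos e) (s.pos f) with h1 | h1 | h1
  · have h2 := h.left_val_lt hb h1
    exact h.low_increasing hb (g := e) (z := e') hv' (by omega) h2 he
  · rw [s.pos_inj] at h1
    subst h1
    exact hlt (h.val_lt hb he)
  · exact h.right_increasing hb h1 he (by omega)

theorem perm_eq_one (h : s.Trapped o t f) (hb : s.IsNormal o b) : s.perm = 1 := by
  have hmono : StrictMono s.perm := by
    intro i j hij
    have := h.monotone hb (e := s.1⁻¹ i) (e' := s.1⁻¹ j) (by simpa [pos] using hij)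
    simpa [val, perm] using this
  have key : ∀ i, s.perm i = i := fun i => congrFun (StrictMono.range_inj hmono strictMono_id |>.1
    (by simp [s.perm.surjective.range_eq])) i
  exact Equiv.ext key

end Trapped
end Labelled
end Rauzy

namespace Rauzy
open Equiv

/-! ### The components of the diagram -/

variable {m : ℕ}

/-- The component of an endpoint. -/
def comp (σ : Perm (Fin (m + 1))) (x : Endpoint (m + 1)) : (diagram σ).ConnectedComponent :=
  (diagram σ).connectedComponentMk x

theorem comp_eq_of_link {σ : Perm (Fin (m + 1))} {x y : Endpoint (m + 1)} (h : Link σ x y) :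
    comp σ x = comp σ y := by
  by_cases hxy : x = y
  · rw [hxy]
  · exact SimpleGraph.ConnectedComponent.sound
      (SimpleGraph.Adj.reachable ((SimpleGraph.fromRel_adj _ _ _).2 ⟨hxy, Or.inl h⟩))

theorem eq_of_comp_eq {α : Sort*} {σ : Perm (Fin (m + 1))} {φ : Endpoint (m + 1) → α}
    (hφ : ∀ x y, Link σ x y → φ x = φ y) {x y : Endpoint (m + 1)} (h : comp σ x = comp σ y) :
    φ x = φ y := by
  obtain ⟨w⟩ := SimpleGraph.ConnectedComponent.exact h
  induction w with
  | nil => rfl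
  | cons hadj _ ih =>
    refine Eq.trans ?_ (ih (SimpleGraph.ConnectedComponent.sound ⟨‹_›⟩))
    rcases ((SimpleGraph.fromRel_adj _ _ _).1 hadj).2 with h | h
    exacts [hφ _ _ h, (hφ _ _ h).symm]

theorem exists_comp_map {α : Sort*} {σ : Perm (Fin (m + 1))} {φ : Endpoint (m + 1) → α}
    (hφ : ∀ x y, Link σ x y → φ x = φ y) :
    ∃ F : (diagram σ).ConnectedComponent → α, ∀ x, F (comp σ x) = φ x :=
  ⟨Quot.lift φ fun _ _ h => eq_of_comp_eq hφ (SimpleGraph.ConnectedComponent.sound h),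
    fun _ => rfl⟩

theorem comp_surjective (σ : Perm (Fin (m + 1))) : Function.Surjective (comp σ) :=
  Quot.mk_surjective

theorem comp_arcTop (σ : Perm (Fin (m + 1))) {j j' : Fin (m + 1)} (h : (j' : ℕ) = j + 1) :
    comp σ (.topWhite j) = comp σ (.topBlack j') := by
  have hj : (j : ℕ) < m := by omega
  rw [show j = Fin.castSucc ⟨j, hj⟩ from rfl, show j' = Fin.succ ⟨j, hj⟩ from Fin.ext h]
  exact comp_eq_of_link (.arcTop _)

theorem comp_arcBot (σ : Perm (Fin (m + 1))) {j j' : Fin (m + 1)} (h : (j' : ℕ) = j + 1) :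
    comp σ (.botWhite j) = comp σ (.botBlack j') := by
  have hj : (j : ℕ) < m := by omega
  rw [show j = Fin.castSucc ⟨j, hj⟩ from rfl, show j' = Fin.succ ⟨j, hj⟩ from Fin.ext h]
  exact comp_eq_of_link (.arcBot _)

theorem comp_edgeBW (σ : Perm (Fin (m + 1))) {i j : Fin (m + 1)} (h : σ i = j) :
    comp σ (.botBlack i) = comp σ (.topWhite j) :=
  h ▸ comp_eq_of_link (.edgeBW i)

theorem comp_edgeWB (σ : Perm (Fin (m + 1))) {i j : Fin (m + 1)} (h : σ i = j) :
    comp σ (.botWhite i) = comp σ (.topBlack j) :=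
  h ▸ comp_eq_of_link (.edgeWB i)

theorem comp_mark (σ : Perm (Fin (m + 1))) {i j : Fin (m + 1)} (hi : (i : ℕ) = m)
    (hj : (j : ℕ) = 0) : comp σ (.topWhite i) = comp σ (.botBlack j) := by
  rw [show i = Fin.last m from Fin.ext hi, show j = 0 from Fin.ext hj]
  exact comp_eq_of_link .mark

/-- To be constant on components, a function has to be constant along the links. -/
theorem link_cases {α : Sort*} {σ : Perm (Fin (m + 1))} {φ : Endpoint (m + 1) → α}
    (h1 : ∀ i, φ (.botBlack i) = φ (.topWhite (σ i)))
    (h2 : ∀ i, φ (.botWhite i) = φ (.topBlack (σ i)))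
    (h3 : ∀ i j : Fin (m + 1), (j : ℕ) = i + 1 → φ (.botWhite i) = φ (.botBlack j))
    (h4 : ∀ i j : Fin (m + 1), (j : ℕ) = i + 1 → φ (.topWhite i) = φ (.topBlack j))
    (h5 : φ (.topWhite (Fin.last m)) = φ (.botBlack 0)) (x y : Endpoint (m + 1))
    (h : Link σ x y) : φ x = φ y := by
  cases h with
  | edgeBW i => exact h1 i
  | edgeWB i => exact h2 i
  | arcBot i => exact h3 _ _ (by simp)
  | arcTop i => exact h4 _ _ (by simp)
  | mark => exact h5

/-- Each top arc is recorded by its black right end. The leftmost black top point ends no arc, hence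
the condition `j ≠ 0`. -/
theorem pathLength_eq (σ : Perm (Fin (m + 1))) (c : (diagram σ).ConnectedComponent) :
    pathLength σ c = {j : Fin (m + 1) | j ≠ 0 ∧ comp σ (.topBlack j) = c}.ncard := by
  rw [pathLength, ← Set.ncard_image_of_injective _ (Fin.succ_injective m)]
  congr 1
  ext j
  simp only [Set.mem_image, Set.mem_ofPred_eq]
  constructor
  · rintro ⟨i, hi, rfl⟩
    exact ⟨Fin.succ_ne_zero i, by rw [← hi]; exact (comp_eq_of_link (.arcTop i)).symm⟩
  · rintro ⟨h0, hj⟩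
    obtain ⟨i, rfl⟩ := Fin.exists_succ_eq.2 h0
    exact ⟨i, by rw [← hj]; exact comp_eq_of_link (.arcTop i), rfl⟩

theorem cycleStructure_eq_of_bijective {m' : ℕ} {σ : Perm (Fin (m + 1))}
    {τ : Perm (Fin (m' + 1))}
    {F : (diagram σ).ConnectedComponent → (diagram τ).ConnectedComponent}
    (hF : Function.Bijective F) (h0 : F (rankPath σ) = rankPath τ)
    (h : ∀ c, c ≠ rankPath σ → pathLength τ (F c) = pathLength σ c) :
    cycleStructure τ = cycleStructure σ := by
  have : (Set.toFinite {c | c ≠ rankPath τ}).toFinset =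
      (Set.toFinite {c | c ≠ rankPath σ}).toFinset.map ⟨F, hF.1⟩ := by
    ext c
    obtain ⟨d, rfl⟩ := hF.2 c
    simp only [Set.Finite.mem_toFinset, Set.mem_ofPred_eq, Finset.mem_map,
      Function.Embedding.coeFn_mk, ← h0, hF.1.ne_iff, hF.1.eq_iff, exists_eq_right]
  rw [cycleStructure, cycleStructure, this, Finset.map_val, Multiset.map_map]
  refine Multiset.map_congr rfl fun c hc => ?_
  exact h c (by simpa using hc)

/-- The components of the diagram of `σ` can be mapped onto those of the diagram of `τ` in a way
that respects the top black endpoints, up to a permutation. -/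
def CompMap (σ τ : Perm (Fin (m + 1))) : Prop :=
  ∃ F : (diagram σ).ConnectedComponent → (diagram τ).ConnectedComponent, Function.Surjective F ∧
    ∃ π : Perm (Fin (m + 1)), π 0 = 0 ∧
      ∀ j, F (comp σ (.topBlack j)) = comp τ (.topBlack (π j))

theorem CompMap.refl (σ : Perm (Fin (m + 1))) : CompMap σ σ :=
  ⟨id, Function.surjective_id, 1, rfl, fun _ => rfl⟩

theorem CompMap.trans {σ τ ρ : Perm (Fin (m + 1))} (h : CompMap σ τ) (h' : CompMap τ ρ) :
    CompMap σ ρ := by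
  obtain ⟨F, hF, π, h0, h⟩ := h
  obtain ⟨F', hF', π', h0', h'⟩ := h'
  exact ⟨F' ∘ F, hF'.comp hF, π' * π, by simp [h0, h0'], fun j => by simp [h, h']⟩

/-- The mark, the black bottom point of the first edge and its white top point form one stretch of a
path, which acts as a cut in the cyclic order of the top points. `L` moves the cut by one place: one
ordinary arc becomes the passage through this stretch, and the old passage becomes an arc. The map
therefore contracts the stretch onto its predecessor. -/
theorem compMap_opL (σ : Perm (Fin (m + 1))) : CompMap σ (opL σ) := by
  set τ := opL σ with hτ
  set γ := gammaR (σ 0) with hγ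
  have hγv : ∀ j, (γ j : ℕ) = if (j : ℕ) ≤ σ 0 then (j : ℕ) else
      if (j : ℕ) = m then (σ 0 : ℕ) + 1 else (j : ℕ) + 1 := gammaR_val _
  by_cases ha : m ≤ σ 0 + 1
  · have : γ = 1 := by
      ext j
      rw [hγv, Perm.one_apply]
      split_ifs <;> omega
    rw [hτ, opL, ← hγ, this, one_mul]
    exact CompMap.refl σ
  have hτi : ∀ i, τ i = γ (σ i) := fun _ => rfl
  have h0 : γ (σ 0) = σ 0 := by ext; rw [hγv, if_pos le_rfl]
  have hl : (γ (Fin.last m) : ℕ) = σ 0 + 1 := by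
    rw [hγv, if_neg (by simp; omega), if_pos (by simp)]
  have hz : comp τ (.botBlack 0) = comp τ (.topWhite (σ 0)) := comp_edgeBW τ (by rw [hτi, h0])
  have hy : comp τ (.topWhite (σ 0)) = comp τ (.topBlack (γ (Fin.last m))) := comp_arcTop τ hl
  obtain ⟨F, hF⟩ := exists_comp_map (σ := σ) (φ := fun x => match x with
    | .botBlack i => if i = 0 then comp τ (.topWhite (γ (Fin.last m))) else comp τ (.botBlack i)
    | .botWhite i => comp τ (.botWhite i)
    | .topBlack j => comp τ (.topBlack (γ j))
    | .topWhite j => if j = σ 0 then comp τ (.topWhite (γ (Fin.last m))) else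
        comp τ (.topWhite (γ j))) (by
    refine link_cases (fun i => ?_) (fun i => ?_) (fun i j hij => ?_) (fun i j hij => ?_) ?_
    · simp only [σ.injective.eq_iff]
      split_ifs
      exacts [rfl, comp_edgeBW τ rfl]
    · exact comp_edgeWB τ rfl
    · dsimp only
      rw [if_neg (by rintro rfl; simp at hij)]
      exact comp_arcBot τ hij
    · have hi := hγv i
      have hj := hγv j
      have := j.is_le
      dsimp only
      split_ifs with h
      · subst h
        refine comp_arcTop τ ?_
        rw [hl, hj]
        split_ifs <;> omega
      · have hne : (i : ℕ) ≠ σ 0 := fun h' => h (Fin.ext h')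
        by_cases hjm : (j : ℕ) = m ∧ (σ 0 : ℕ) < i
        · rw [comp_mark τ (j := 0) (by rw [hi]; split_ifs <;> omega) rfl, hz, hy,
            show j = Fin.last m from Fin.ext hjm.1]
        · refine comp_arcTop τ ?_
          rw [hi, hj]
          split_ifs <;> omega
    · simp)
  refine ⟨F, fun c => ?_, γ, ?_, fun j => hF _⟩
  · have htb : ∀ j, ∃ a, F a = comp τ (.topBlack j) := fun j =>
      ⟨comp σ (.topBlack (γ⁻¹ j)), by rw [hF]; simp⟩
    obtain ⟨x, rfl⟩ := comp_surjective τ c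
    cases x with
    | botBlack i =>
      by_cases hi : i = 0
      · rw [hi, hz, hy]; exact htb _
      · exact ⟨comp σ (.botBlack i), by rw [hF]; simp [hi]⟩
    | botWhite i => exact ⟨comp σ (.botWhite i), hF _⟩
    | topBlack j => exact htb j
    | topWhite j =>
      by_cases hj : j = σ 0
      · rw [hj, hy]; exact htb _
      · obtain ⟨i, rfl⟩ := γ.surjective j
        exact ⟨comp σ (.topWhite i), by rw [hF]; exact if_neg fun h => hj (by rw [h, h0])⟩
  · ext; rw [hγv, if_pos (by simp)]

/-- This is the bottom counterpart: the stretch consists of the black bottom point of the edge `k`,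
its white top point and the mark. The old passage from `k - 1` to `0` becomes the arc from `k - 2`
to `k - 1`, and the old arc from `0` to `1` becomes the passage. -/
theorem compMap_opR (σ : Perm (Fin (m + 1))) : CompMap σ (opR σ) := by
  set τ := opR σ with hτ
  set k := σ⁻¹ (Fin.last m) with hk
  set γ := gammaL k with hγ
  have hγv : ∀ j, (γ j : ℕ) = if (k : ℕ) ≤ j then (j : ℕ) else
      if (j : ℕ) = 0 then (k : ℕ) - 1 else (j : ℕ) - 1 := gammaL_val _
  by_cases ha : (k : ℕ) ≤ 1
  · have : γ = 1 := by
      ext j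
      rw [hγv, Perm.one_apply]
      split_ifs <;> omega
    rw [hτ, opR, ← hk, ← hγ, this, inv_one, mul_one]
    exact CompMap.refl σ
  have hkm := k.is_le
  have hτi : ∀ i, τ (γ i) = σ i := fun i => by simp [hτ, opR, ← hk, ← hγ]
  have hσk : σ k = Fin.last m := by simp [hk]
  have hσl : ∀ i, σ i = Fin.last m ↔ i = k := fun i => by rw [← hσk, σ.injective.eq_iff]
  have hγk : γ k = k := by ext; rw [hγv, if_pos le_rfl]
  have hτk : τ k = Fin.last m := by rw [← hγk, hτi, hσk]
  let one : Fin (m + 1) := ⟨1, by omega⟩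
  let pred : Fin (m + 1) := ⟨k - 1, by omega⟩
  have hone : (γ one : ℕ) = 0 := by
    rw [hγv]; simp only [one]; split_ifs <;> first | omega | contradiction
  have hpred : (γ pred : ℕ) = k - 2 := by
    rw [hγv]; simp only [pred]; split_ifs <;> omega
  have hone' : one ≠ k := fun h => ha (by rw [← h])
  have hz : comp τ (.botBlack k) = comp τ (.topWhite (Fin.last m)) := comp_edgeBW τ hτk
  have hy : comp τ (.topWhite (Fin.last m)) = comp τ (.botBlack (γ one)) := comp_mark τ rfl hone
  obtain ⟨F, hF⟩ := exists_comp_map (σ := σ) (φ := fun x => match x with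
    | .botBlack i => if i = k then comp τ (.botWhite (γ pred)) else comp τ (.botBlack (γ i))
    | .botWhite i => comp τ (.botWhite (γ i))
    | .topBlack j => comp τ (.topBlack j)
    | .topWhite j => if j = Fin.last m then comp τ (.botWhite (γ pred)) else
        comp τ (.topWhite j)) (by
    refine link_cases (fun i => ?_) (fun i => ?_) (fun i j hij => ?_) (fun i j hij => ?_) ?_
    · simp only [hσl]
      split_ifs
      exacts [rfl, comp_edgeBW τ (hτi i)]
    · exact comp_edgeWB τ (hτi i)
    · have hi := hγv i
      have hj := hγv j
      have := j.is_le
      dsimp only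
      split_ifs with h
      · subst h
        rw [show i = pred from Fin.ext (by simp only [pred]; omega)]
      · have hne : (j : ℕ) ≠ k := fun h' => h (Fin.ext h')
        by_cases hi0 : (i : ℕ) = 0
        · rw [show j = one from Fin.ext (by simp only [one]; omega), ← hy, ← hz]
          refine comp_arcBot τ ?_
          rw [hi]
          split_ifs <;> omega
        · refine comp_arcBot τ ?_
          rw [hi, hj]
          split_ifs <;> omega
    · dsimp only
      rw [if_neg (by rintro rfl; have := j.is_le; simp at hij; omega)]
      exact comp_arcTop τ hij
    · simp only [if_true]
      rw [if_neg (by intro h; rw [← h] at ha; simp at ha)]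
      refine comp_arcBot τ ?_
      rw [hpred, hγv]
      simp only [Fin.val_zero]
      split_ifs <;> omega)
  refine ⟨F, fun c => ?_, 1, rfl, fun j => hF _⟩
  obtain ⟨x, rfl⟩ := comp_surjective τ c
  have h1 : F (comp σ (.botBlack one)) = comp τ (.botBlack (γ one)) := by
    rw [hF]; simp [hone']
  cases x with
  | botBlack i =>
    by_cases hi : i = k
    · exact ⟨_, by rw [hi, hz, hy]; exact h1⟩
    · obtain ⟨j, rfl⟩ := γ.surjective i
      exact ⟨comp σ (.botBlack j), by rw [hF]; exact if_neg fun h => hi (by rw [h, hγk])⟩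
  | botWhite i => exact ⟨comp σ (.botWhite (γ⁻¹ i)), by rw [hF]; simp⟩
  | topBlack j => exact ⟨comp σ (.topBlack j), hF _⟩
  | topWhite j =>
    by_cases hj : j = Fin.last m
    · exact ⟨_, by rw [hj, hy]; exact h1⟩
    · exact ⟨comp σ (.topWhite j), by rw [hF]; simp [hj]⟩

theorem compMap_of_connected {σ τ : Perm (Fin (m + 1))} (h : Connected σ τ) : CompMap σ τ := by
  induction h with
  | refl => exact CompMap.refl σ
  | tail _ h ih =>
    rcases h with rfl | rfl
    exacts [ih.trans (compMap_opL _), ih.trans (compMap_opR _)]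

/-- Connectedness is symmetric, so there are surjections in both directions between finite sets, and
each of them is a bijection. -/
theorem cycleStructure_rank_eq {σ τ : Perm (Fin (m + 1))} (h : Connected σ τ) :
    cycleStructure τ = cycleStructure σ ∧ rank τ = rank σ := by
  obtain ⟨F, hF, π, h0, hπ⟩ := compMap_of_connected h
  obtain ⟨G, hG, -⟩ := compMap_of_connected h.symm
  have hbij : Function.Bijective F :=
    (Nat.bijective_iff_surjective_and_card F).2 ⟨hF, le_antisymm
      (Nat.card_le_card_of_surjective G hG) (Nat.card_le_card_of_surjective F hF)⟩
  have hr : F (rankPath σ) = rankPath τ := by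
    have := hπ 0
    rwa [h0] at this
  have hlen : ∀ c, pathLength τ (F c) = pathLength σ c := by
    intro c
    rw [pathLength_eq, pathLength_eq, ← Set.ncard_image_of_injective
      {j : Fin (m + 1) | j ≠ 0 ∧ comp σ (.topBlack j) = c} π.injective]
    congr 1
    ext j
    obtain ⟨i, rfl⟩ := π.surjective j
    simp only [Set.mem_ofPred_eq, π.injective.mem_set_image, ← hπ, hbij.1.eq_iff, ne_eq]
    rw [← h0, π.injective.eq_iff, h0]
  exact ⟨cycleStructure_eq_of_bijective hbij hr fun c _ => hlen c, by rw [rank, ← hr, hlen, rank]⟩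

end Rauzy

namespace Rauzy
open Equiv

/-! ### The operator `T` in coordinates -/

variable {m : ℕ}

theorem insertEdge_at {k : ℕ} (σ : Perm (Fin k)) (p q : Fin (k + 1)) : insertEdge σ p q p = q := by
  simp [insertEdge]

theorem insertEdge_succAbove {k : ℕ} (σ : Perm (Fin k)) (p q : Fin (k + 1)) (i : Fin k) :
    insertEdge σ p q (p.succAbove i) = q.succAbove (σ i) := by
  simp [insertEdge]

/-- The position in `T σ` of a top endpoint of `σ`. -/
def shiftTop (σ : Perm (Fin (m + 1))) (j : Fin (m + 1)) : Fin (m + 3) :=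
  ((σ 0).succ.succAbove j).succ

theorem shiftTop_val (σ : Perm (Fin (m + 1))) (j : Fin (m + 1)) :
    (shiftTop σ j : ℕ) = if (j : ℕ) ≤ σ 0 then (j : ℕ) + 1 else (j : ℕ) + 2 := by
  simp only [shiftTop, Fin.val_succ, Fin.succAbove, Fin.lt_def, Fin.val_castSucc]
  split_ifs <;> simp <;> omega

theorem opT_zero (σ : Perm (Fin (m + 1))) : (opT σ 0 : ℕ) = σ 0 + 2 := by
  have h : (0 : Fin (m + 3)) = (1 : Fin (m + 3)).succAbove 0 := by
    ext; simp [Fin.succAbove]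
  rw [opT, h, insertEdge_succAbove, insertEdge_at]
  simp

theorem opT_one (σ : Perm (Fin (m + 1))) : opT σ 1 = 0 := by
  rw [opT, insertEdge_at]

theorem opT_succ_succ (σ : Perm (Fin (m + 1))) (i : Fin (m + 1)) :
    opT σ i.succ.succ = shiftTop σ (σ i) := by
  have h : i.succ.succ = (1 : Fin (m + 3)).succAbove ((0 : Fin (m + 2)).succAbove i) := by
    ext; simp [Fin.succAbove, Fin.lt_def]
  rw [opT, h, insertEdge_succAbove, insertEdge_succAbove, shiftTop, Fin.succAbove_zero]

theorem opT_val (σ : Perm (Fin (m + 1))) {i : Fin (m + 1)} {p : Fin (m + 3)}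
    (h : (p : ℕ) = i + 2) :
    (opT σ p : ℕ) = if (σ i : ℕ) ≤ σ 0 then (σ i : ℕ) + 1 else (σ i : ℕ) + 2 := by
  rw [show p = i.succ.succ from Fin.ext (by simp [h]), opT_succ_succ, shiftTop_val]

theorem fin_cases_two {p : Fin (m + 3)} :
    p = 0 ∨ p = 1 ∨ ∃ i : Fin (m + 1), p = i.succ.succ := by
  rcases Fin.eq_zero_or_eq_succ p with h | ⟨q, rfl⟩
  · exact Or.inl h
  · rcases Fin.eq_zero_or_eq_succ q with rfl | ⟨i, rfl⟩
    · exact Or.inr (Or.inl rfl)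
    · exact Or.inr (Or.inr ⟨i, rfl⟩)

theorem opT_isIrreducible {σ : Perm (Fin (m + 1))} (h : (σ 0 : ℕ) ≠ m) :
    IsIrreducible (opT σ) := by
  by_contra hn
  obtain ⟨k, h1, h2, h3⟩ := (not_isIrreducible_iff _).1 hn
  have a1 := h3 0
  have a2 := h3 1
  rw [opT_zero] at a1
  rw [opT_one] at a2
  have := (σ 0).is_le
  simp at a1 a2
  omega

/-- The first edge of `T σ` ends just to the right of the copy of the first edge of `σ`, so the top
points that `L` rotates are the same in both diagrams. -/
theorem opT_opL (σ : Perm (Fin (m + 1))) : opT (opL σ) = opL (opT σ) := by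
  have h0 : (opL σ 0 : ℕ) = σ 0 := by rw [opL_zero]
  ext p
  rw [opL_val (opT σ), opT_zero]
  rcases fin_cases_two (p := p) with rfl | rfl | ⟨i, rfl⟩
  · rw [opT_zero, opT_zero, h0, if_pos le_rfl]
  · rw [opT_one, opT_one]; simp
  · rw [opT_val (i := i) _ (by simp), opT_val (i := i) _ (by simp), h0, opL_val]
    have := (σ i).is_le
    split_ifs <;> omega

/-- Every permutation that starts with `3, 1, 2` comes from `T`. -/
theorem exists_opT_eq {τ : Perm (Fin (m + 3))} (h0 : (τ 0 : ℕ) = 2) (h1 : τ 1 = 0)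
    (h2 : (τ 2 : ℕ) = 1) : ∃ σ : Perm (Fin (m + 1)), σ 0 = 0 ∧ opT σ = τ := by
  have hne : ∀ {p q : Fin (m + 3)}, (p : ℕ) ≠ q → (τ p : ℕ) ≠ τ q := fun h h' =>
    h (congrArg _ (τ.injective (Fin.ext h')))
  have h3 : ∀ i : Fin (m + 1), (i : ℕ) ≠ 0 → 3 ≤ (τ i.succ.succ : ℕ) := by
    intro i hi
    have a0 := hne (p := i.succ.succ) (q := 0) (by simp)
    have a1 := hne (p := i.succ.succ) (q := 1) (by simp)
    have a2 := hne (p := i.succ.succ) (q := 2) (by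
      rw [show ((2 : Fin (m + 3)) : ℕ) = 2 from rfl]; simpa using hi)
    rw [h0] at a0
    rw [h1, Fin.val_zero] at a1
    rw [h2] at a2
    omega
  let φ : Fin (m + 1) → Fin (m + 1) := fun i =>
    ⟨if (i : ℕ) = 0 then 0 else (τ i.succ.succ : ℕ) - 2, by
      have := (τ i.succ.succ).is_lt
      split_ifs <;> omega⟩
  have hφ : ∀ i, (φ i : ℕ) = if (i : ℕ) = 0 then 0 else (τ i.succ.succ : ℕ) - 2 := fun _ => rfl
  have hinj : Function.Injective φ := by
    intro i j hij
    have := congrArg Fin.val hij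
    rw [hφ, hφ] at this
    by_contra hne'
    have hij' : (i : ℕ) ≠ j := fun h => hne' (Fin.ext h)
    have a := hne (p := i.succ.succ) (q := j.succ.succ) (by simpa using hij')
    have b := h3 i
    have c := h3 j
    split_ifs at this <;> omega
  let σ : Perm (Fin (m + 1)) := Equiv.ofBijective φ (Finite.injective_iff_bijective.1 hinj)
  have hσ : ∀ i, σ i = φ i := fun _ => rfl
  have hσ0 : σ 0 = 0 := by ext; rw [hσ, hφ]; simp
  refine ⟨σ, hσ0, ?_⟩
  ext p
  rcases fin_cases_two (p := p) with rfl | rfl | ⟨i, rfl⟩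
  · rw [opT_zero, hσ0, h0]; rfl
  · rw [opT_one, h1]
  · rw [opT_val (i := i) _ (by simp), hσ0, hσ, hφ]
    by_cases hi : (i : ℕ) = 0
    · have : i = 0 := Fin.ext hi
      subst this
      simpa using h2.symm
    · have := h3 i hi
      rw [if_neg hi, if_neg (by simp; omega)]
      omega

/-- The top point that `T` inserts next to that of the first edge could only separate the values `σ
0 + 1` and `σ 0`, and the latter is not taken at a successor position. So a descent stays a descent,
and a special descent stays special. -/
theorem opT_primitive {σ : Perm (Fin (m + 1))} (h : IsPrimitive (opT σ)) : IsPrimitive σ := by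
  intro i
  have hne : ∀ {p q : Fin (m + 1)}, (p : ℕ) ≠ q → (σ p : ℕ) ≠ σ q := fun h h' =>
    h (congrArg _ (σ.injective (Fin.ext h')))
  obtain ⟨h1, h2⟩ := h i.succ.succ
  have b1 := opT_val σ (i := i.succ) (p := i.succ.succ.succ) (by simp)
  have b2 := opT_val σ (i := i.castSucc) (p := i.succ.succ.castSucc) (by simp)
  have a1 := hne (p := i.succ) (q := 0) (by simp)
  have a3 : (σ i.castSucc : ℕ) = σ 0 ∨ (σ i.castSucc : ℕ) ≠ σ 0 := by omega
  have := (σ 0).is_le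
  rw [IsDescent, b1, b2] at h1
  rw [IsSpecialDescent, ← Fin.val_inj, opT_zero, b1, b2, Fin.val_last] at h2
  rw [IsDescent, IsSpecialDescent, ← Fin.val_inj, Fin.val_last]
  constructor
  · intro hd
    apply h1
    split_ifs <;> omega
  · rintro ⟨hd, hl⟩
    apply h2
    split_ifs <;> omega

/-! ### The operator `T` is compatible with the dynamics -/

/-- The handle at the edges `E`, `O`, `H` can be moved to the next edge `b`. -/
theorem Labelled.exists_slide (s : Labelled m) {E O H b X : Fin (m + 1)} {k : ℕ} (hk : 1 < k)
    (pE : s.pos E = 0) (pO : s.pos O = 1) (pH : s.pos H = 2) (pb : s.pos b = 3)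
    (pX : s.pos X = k + 2) (vO : s.val O = 0) (vE : s.val E = s.val H + 1) (vX : s.val X = m) :
    ∃ t, Tracks s t ∧
      (∀ e, t.pos e = if s.pos e < 2 then s.pos e else if s.pos e = 2 then k + 1 else
        if s.pos e < k + 2 then s.pos e - 1 else s.pos e) ∧
      ∀ e, t.val e = if s.val b < s.val H then
          if s.val e ≤ s.val b then s.val e else if s.val e < s.val E then s.val e + 1 else
          if s.val e = s.val E then s.val b + 1 else s.val e
        else if s.val e < s.val E then s.val e else if s.val e = s.val E then s.val b else
          if s.val e ≤ s.val b then s.val e - 1 else s.val e := by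
  have hne : ∀ {e e'}, s.pos e ≠ s.pos e' → s.val e ≠ s.val e' := fun h h' =>
    h (s.pos_inj.2 (s.val_inj.1 h'))
  have n1 : s.val b ≠ s.val H := hne (by omega)
  have n2 : s.val b ≠ s.val E := hne (by omega)
  have n3 : s.val b ≠ s.val O := hne (by omega)
  have n4 : s.val H ≠ s.val O := hne (by omega)
  have n5 : s.val b ≠ s.val X := hne (by omega)
  have n6 : s.val E ≠ s.val X := hne (by omega)
  have n7 := s.val_le b
  have n8 := s.val_le E
  -- Two rotations make `O`, `H` the first two edges of a normal state, with `E` directly to the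
  -- left of `X` at the bottom and directly above `H` at the top.
  obtain ⟨s1, t1, w1, q1⟩ := s.exists_rotate_pos (w := X) (x := O) vX (by omega)
  simp only [pX, pO] at q1
  have o1 : s1.pos O = 0 := by rw [q1]; split_ifs <;> omega
  have u1 : s1.val O = 0 := by rw [w1, vO]
  obtain ⟨s2, t2, q2, w2⟩ := s1.exists_rotate_val_first (o := O) (y := H) o1
    (by rw [w1, w1]; omega)
  simp only [u1, w1] at w2
  simp only [q1] at q2
  have hn : s2.IsNormal O H := by
    constructor
    · rw [q2]; split_ifs <;> omega
    · rw [w2]; split_ifs <;> omega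
    · rw [q2]; split_ifs <;> omega
    · rw [w2]; split_ifs <;> omega
  have f1 : s2.pos b = 2 := by rw [q2]; split_ifs <;> omega
  have f2 : s2.pos E = k + 1 := by rw [q2]; split_ifs <;> omega
  have f3 : s2.val E = 2 := by rw [w2]; split_ifs <;> omega
  have f4 : s2.val b = if s.val b < s.val H then s.val b + m + 1 - s.val H else
      s.val b - s.val H + 1 := by
    rw [w2]; split_ifs <;> omega
  have f5 : s2.val X = m + 1 - s.val H := by rw [w2]; split_ifs <;> omega
  have f6 : s2.pos X = k + 2 := by rw [q2]; split_ifs <;> omega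
  -- The exchange puts `b` in the place of `H`, and `H` directly to the left of `E`. The remaining
  -- two rotations undo the first two.
  obtain ⟨s3, hx, -⟩ := hn.exists_exchange (g := b) (z := E) (by omega)
    (by rw [f4]; split_ifs <;> omega) (by omega)
  have q3 := hx.pos_eq
  have w3 := hx.val_eq
  simp only [f1, f2, f3] at q3 w3
  have o3 : s3.pos O = 0 := by rw [q3, hn.pos_fst, if_pos rfl]
  have u3 : s3.val O = 0 := by rw [w3, hn.val_fst, if_pos rfl]
  have e3 : s3.pos E = k + 1 := by rw [q3, f2]; split_ifs <;> omega
  have x3 : s3.pos X = k + 2 := by rw [q3, f6]; split_ifs <;> omega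
  have y3 : s3.val X = if s.val b < s.val H then m + 1 - s.val b else m + 2 - s.val b := by
    have := w3 X
    rw [f5] at this
    by_cases hlt : s.val b < s.val H
    · rw [if_pos hlt] at f4 ⊢
      repeat (first | rw [if_pos (by omega)] at this | rw [if_neg (by omega)] at this)
      omega
    · rw [if_neg hlt] at f4 ⊢
      repeat (first | rw [if_pos (by omega)] at this | rw [if_neg (by omega)] at this)
      omega
  obtain ⟨s4, t4, q4, w4⟩ := s3.exists_rotate_val_last (o := O) (y := X) o3
    (by rw [u3, y3]; split_ifs <;> omega)
  simp only [u3] at w4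
  have z4 : s4.val X = m := by
    have := s3.val_le X
    have : 0 < s3.val X := by rw [y3]; split_ifs <;> omega
    rw [w4, if_neg (by omega), if_pos (by omega)]
    omega
  obtain ⟨s5, t5, w5, q5⟩ := s4.exists_rotate_pos (w := X) (x := E) z4 (by rw [q4, q4]; omega)
  simp only [q4, e3, x3] at q5
  refine ⟨s5, (((t1.trans t2).trans hx.tracks).trans t4).trans t5, fun e => ?_, fun e => ?_⟩
  · have i1 := q2 e
    have i2 := q3 e
    rw [q5]
    generalize s.pos e = x at *
    generalize s2.pos e = x2 at *
    generalize s3.pos e = x3 at *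
    clear * - i1 i2 hk
    split_ifs at i1 <;> split_ifs at i2 <;> split_ifs <;> omega
  · have j1 := w2 e
    have j2 := w3 e
    have j3 := w4 e
    rw [w5]
    have := s.val_le e
    generalize s.val e = x at *
    generalize s2.val e = x2 at *
    generalize s3.val e = x3 at *
    generalize s4.val e = x4 at *
    generalize s3.val X = y at *
    generalize s2.val b = c at *
    generalize s.val b = B at *
    generalize s.val E = A' at *
    generalize s.val H = A at *
    clear * - j1 j2 j3 this n1 n2 n3 n4 n5 n6 n7 n8 vO vE vX f4 y3
    by_cases hBA : B < A
    · rw [if_pos hBA] at f4 y3 ⊢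
      have r : x = 0 ∨ (0 < x ∧ x < B) ∨ x = B ∨ (B < x ∧ x < A) ∨ x = A ∨ x = A + 1 ∨
        A + 1 < x := by omega
      rcases r with r | r | r | r | r | r | r
      all_goals
        repeat (first | rw [if_pos (by omega)] at j1 | rw [if_neg (by omega)] at j1)
        repeat (first | rw [if_pos (by omega)] at j2 | rw [if_neg (by omega)] at j2)
        repeat (first | rw [if_pos (by omega)] at j3 | rw [if_neg (by omega)] at j3)
        repeat (first | rw [if_pos (by omega)] | rw [if_neg (by omega)])
        omega
    · rw [if_neg hBA] at f4 y3 ⊢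
      have r : x = 0 ∨ (0 < x ∧ x < A) ∨ x = A ∨ x = A + 1 ∨ (A + 1 < x ∧ x < B) ∨ x = B ∨
        B < x := by omega
      rcases r with r | r | r | r | r | r | r
      all_goals
        repeat (first | rw [if_pos (by omega)] at j1 | rw [if_neg (by omega)] at j1)
        repeat (first | rw [if_pos (by omega)] at j2 | rw [if_neg (by omega)] at j2)
        repeat (first | rw [if_pos (by omega)] at j3 | rw [if_neg (by omega)] at j3)
        repeat (first | rw [if_pos (by omega)] | rw [if_neg (by omega)])
        omega

theorem opR_val (σ : Perm (Fin (m + 1))) {p q : Fin (m + 1)}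
    (h : (q : ℕ) = if (σ⁻¹ (Fin.last m) : ℕ) ≤ p then (p : ℕ) else
      if (p : ℕ) + 1 = σ⁻¹ (Fin.last m) then 0 else (p : ℕ) + 1) : opR σ p = σ q := by
  rw [opR, Perm.mul_apply]
  congr 1
  exact Fin.ext (by rw [gammaL_inv_val, h])

/-- The permutation `T (R σ)` is obtained from `T σ` by an exchange. -/
theorem connected_opT_opR (σ : Perm (Fin (m + 1))) : Connected (opT σ) (opT (opR σ)) := by
  obtain ⟨k, hk⟩ : ∃ k, k = σ⁻¹ (Fin.last m) := ⟨_, rfl⟩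
  have hkm := k.is_le
  have hσk : σ k = Fin.last m := by simp [hk]
  by_cases ha : (k : ℕ) ≤ 1
  · have : gammaL k = 1 := by
      ext j
      rw [gammaL_val, Perm.one_apply]
      split_ifs <;> omega
    rw [opR, ← hk, this, inv_one, mul_one]
    exact Connected.refl _
  have hne : ∀ {p q : Fin (m + 1)}, (p : ℕ) ≠ q → (σ p : ℕ) ≠ σ q := fun h h' =>
    h (congrArg _ (σ.injective (Fin.ext h')))
  obtain ⟨one, hone⟩ : ∃ i : Fin (m + 1), (i : ℕ) = 1 := ⟨⟨1, by omega⟩, rfl⟩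
  have hA : (σ 0 : ℕ) ≠ σ one := hne (by simp [hone])
  have hσm : (σ k : ℕ) = m := by rw [hσk, Fin.val_last]
  have hAm : (σ 0 : ℕ) ≠ σ k := hne (by simp; omega)
  have hBm : (σ one : ℕ) ≠ σ k := hne (by omega)
  rw [hσm] at hAm hBm
  have hA' := (σ 0).is_le
  have hB' := (σ one).is_le
  obtain ⟨s, hs, hp, hv⟩ := Labelled.exists_perm_eq (opT σ)
  have vi : ∀ i : Fin (m + 1), s.val i.succ.succ =
      if (σ i : ℕ) ≤ σ 0 then (σ i : ℕ) + 1 else (σ i : ℕ) + 2 := fun i => by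
    rw [hv, opT_val (i := i) _ (by simp)]
  have v0 : s.val 0 = σ 0 + 2 := by rw [hv, opT_zero]
  have v1 : s.val 1 = 0 := by rw [hv, opT_one]; rfl
  have p0 : s.pos 0 = 0 := hp 0
  have p1 : s.pos 1 = 1 := hp 1
  have pi : ∀ i : Fin (m + 1), s.pos i.succ.succ = i + 2 := fun i => by rw [hp]; simp
  generalize hH : (0 : Fin (m + 1)).succ.succ = H
  generalize hb : one.succ.succ = b
  generalize hX : k.succ.succ = X
  have vH := vi 0
  have vb := vi one
  have vX := vi k
  have pH := pi 0
  have pb := pi one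
  have pX := pi k
  rw [hH, if_pos le_rfl] at vH
  rw [hb] at vb pb
  rw [hX, hσm, if_neg (by omega)] at vX
  rw [hH, Fin.val_zero] at pH
  rw [hX] at pX
  -- `E` and `O` are the two edges added by `T`, `H` and `b` come from the first two edges of `σ`,
  -- and `X` from the edge with the last top endpoint. Sliding moves `H` to the place where `R` puts
  -- the first edge.
  obtain ⟨t, ht, q, w⟩ := s.exists_slide (E := 0) (O := 1) (H := H) (b := b) (X := X) (k := k)
    (by omega) p0 p1 pH (by omega) pX v1 (by omega) vX
  have ht := ht.connected
  rw [hs] at ht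
  convert ht using 1
  have hR0 : opR σ 0 = σ one := opR_val σ (by rw [← hk, Fin.val_zero]; split_ifs <;> omega)
  have key : ∀ e, (opT (opR σ) (t.1 e) : ℕ) = t.val e := by
    intro e
    have pe : ((t.1 e : Fin (m + 3)) : ℕ) = t.pos e := rfl
    have q := q e
    have w := w e
    rcases fin_cases_two (p := e) with rfl | rfl | ⟨i, rfl⟩
    · have : t.1 0 = 0 := Fin.ext (by rw [pe, q, p0]; rfl)
      rw [this, opT_zero, hR0, w, v0, vb, vH]
      split_ifs <;> omega
    · have : t.1 1 = 1 := Fin.ext (by rw [pe, q, p1]; rfl)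
      rw [this, opT_one, w, v1, v0, vb, vH, Fin.val_zero]
      split_ifs <;> omega
    · have hj : ∃ j : Fin (m + 1), t.pos i.succ.succ = j + 2 ∧ opR σ j = σ i := by
        rw [pi] at q
        have hi := i.is_le
        obtain ⟨y, hy⟩ : ∃ y : Fin (m + 1), (y : ℕ) = t.pos i.succ.succ - 2 :=
          ⟨⟨t.pos i.succ.succ - 2, by rw [q]; split_ifs <;> omega⟩, rfl⟩
        refine ⟨y, ?_, opR_val σ ?_⟩
        · rw [hy, q]; split_ifs <;> omega
        · rw [← hk, hy, q]; split_ifs <;> omega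
      obtain ⟨j, hj, hji⟩ := hj
      rw [opT_val (i := j) _ (by rw [pe, hj]), hji, hR0, w, v0, vH]
      have vx := vi i
      have hi : (i : ℕ) = 0 ∨ (i : ℕ) = 1 ∨ (σ i : ℕ) ≠ σ 0 ∧ (σ i : ℕ) ≠ σ one := by
        by_cases h0 : (i : ℕ) = 0
        · exact Or.inl h0
        by_cases h1 : (i : ℕ) = 1
        · exact Or.inr (Or.inl h1)
        · exact Or.inr (Or.inr ⟨hne (by simpa using h0), hne (by omega)⟩)
      have hAB : (σ one : ℕ) < σ 0 ∨ (σ 0 : ℕ) < σ one := by omega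
      have hi' : (σ i : ℕ) = σ 0 ∨ (σ i : ℕ) = σ one ∨ (σ i : ℕ) ≠ σ 0 ∧ (σ i : ℕ) ≠ σ one := by
        rcases hi with hi | hi | hi
        · rw [show i = 0 from Fin.ext hi]; exact Or.inl rfl
        · rw [show i = one from Fin.ext (hi.trans hone.symm)]; exact Or.inr (Or.inl rfl)
        · exact Or.inr (Or.inr hi)
      generalize s.val i.succ.succ = y at *
      generalize s.val b = c at *
      generalize (σ i : ℕ) = x at *
      generalize (σ 0 : ℕ) = A at *
      generalize (σ one : ℕ) = B at *
      clear * - hi' hAB vx vb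
      -- The position of `x` relative to both thresholds decides every conditional.
      have r : x < A ∧ x < B ∨ A < x ∧ B < x ∨ x < A ∧ B < x ∨ A < x ∧ x < B ∨ x = A ∨ x = B := by
        omega
      rcases hAB with hAB | hAB <;> rcases r with r | r | r | r | r | r
      all_goals
        repeat (first | rw [if_pos (by omega)] at vb | rw [if_neg (by omega)] at vb)
        repeat (first | rw [if_pos (by omega)] at vx | rw [if_neg (by omega)] at vx)
        repeat (first | rw [if_pos (by omega)] | rw [if_neg (by omega)])
        omega
  exact Equiv.ext fun p => by
    obtain ⟨e, rfl⟩ := t.1.surjective p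
    rw [Labelled.perm_apply]
    exact Fin.ext (key e)

end Rauzy

namespace Rauzy
open Equiv

/-! ### The cycle invariant of `T σ` -/

variable {m : ℕ}

theorem shiftTop_injective (σ : Perm (Fin (m + 1))) : Function.Injective (shiftTop σ) :=
  (Fin.succ_injective _).comp (Fin.succAbove_right_injective)

/-- The components of the diagram of `T σ` are those of the diagram of `σ`. -/
theorem exists_comp_bijective_opT (σ : Perm (Fin (m + 1))) :
    ∃ F : (diagram σ).ConnectedComponent → (diagram (opT σ)).ConnectedComponent,
      Function.Bijective F ∧ F (rankPath σ) = rankPath (opT σ) ∧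
      (∀ j, comp (opT σ) (.topBlack (shiftTop σ j)) = F (comp σ (.topBlack j))) ∧
      comp (opT σ) (.topBlack (σ 0).succ.succ) = rankPath (opT σ) := by
  set τ := opT σ with hτ
  set a := σ 0 with ha
  have τ0 : τ 0 = a.succ.succ := Fin.ext (by rw [opT_zero]; simp [ha])
  have τ1 : τ 1 = 0 := opT_one σ
  have τi : ∀ i : Fin (m + 1), τ i.succ.succ = (a.succ.succAbove (σ i)).succ := opT_succ_succ σ
  -- The first edge of `σ` is split between two edges of `T σ`: its half with the black bottom point
  -- is carried by the edge `0`, the other half by the edge `2`. Hence black top points skip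
  -- `a.succ` and white ones `a.castSucc`, and the two embeddings agree away from `a`.
  have hne : ∀ {j : Fin (m + 1)}, j ≠ a → a.succ.succAbove j = a.castSucc.succAbove j := by
    intro j hj
    have hj : (j : ℕ) ≠ a := fun h => hj (Fin.ext h)
    ext
    simp only [Fin.succAbove, Fin.lt_def, Fin.val_castSucc, Fin.val_succ]
    split_ifs <;> simp <;> omega
  have hup : ∀ {j j' : Fin (m + 1)}, (j' : ℕ) = j + 1 →
      (a.succ.succAbove j' : ℕ) = a.castSucc.succAbove j + 1 := by
    intro j j' hj
    simp only [Fin.succAbove, Fin.lt_def, Fin.val_castSucc, Fin.val_succ]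
    split_ifs <;> simp <;> omega
  have haa : a.castSucc.succAbove a = a.succ := Fin.succAbove_castSucc_self a
  have haa' : a.succ.succAbove a = a.castSucc := Fin.succAbove_succ_self a
  have hz : a.succ.succAbove 0 = 0 := by
    ext; simp [Fin.succAbove, Fin.lt_def]
  have hlast : a.castSucc.succAbove (Fin.last m) = Fin.last (m + 1) := by
    ext
    have := a.is_le
    simp only [Fin.succAbove, Fin.lt_def, Fin.val_castSucc, Fin.val_last]
    split_ifs <;> simp <;> omega
  let rk := rankPath σ
  -- the retraction of the diagram of `T σ`
  obtain ⟨G, hG⟩ := exists_comp_map (σ := τ) (φ := fun x => match x with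
    | .botBlack p => (Fin.cases (comp σ (.botBlack 0)) (Fin.cases rk fun i => if i = 0 then rk else
        comp σ (.botBlack i)) p : (diagram σ).ConnectedComponent)
    | .botWhite p => Fin.cases rk (Fin.cases rk fun i => comp σ (.botWhite i)) p
    | .topBlack q => Fin.cases rk (Fin.insertNth a.succ rk fun j => comp σ (.topBlack j)) q
    | .topWhite q => Fin.cases rk (Fin.insertNth a.castSucc rk fun j => comp σ (.topWhite j)) q) (by
    refine link_cases (fun p => ?_) (fun p => ?_) (fun p p' hp => ?_) (fun q q' hq => ?_) ?_
    · rcases fin_cases_two (p := p) with rfl | rfl | ⟨i, rfl⟩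
      · rw [τ0, ← haa]
        simp only [Fin.cases_zero, Fin.cases_succ, Fin.insertNth_apply_succAbove]
        exact comp_edgeBW σ ha.symm
      · rw [τ1]; rfl
      · rw [τi]
        by_cases hi : i = 0
        · subst hi
          rw [← ha, haa']
          simp only [Fin.cases_succ, Fin.insertNth_apply_same, if_true]
        · rw [hne (by rw [ha, σ.injective.ne_iff]; exact hi)]
          simpa [hi] using comp_edgeBW σ rfl
    · rcases fin_cases_two (p := p) with rfl | rfl | ⟨i, rfl⟩
      · rw [τ0]; simp
      · rw [τ1]; rfl
      · rw [τi]; simpa using comp_edgeWB σ rfl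
    · rcases fin_cases_two (p := p) with rfl | rfl | ⟨i, rfl⟩
      · rw [show p' = 1 from Fin.ext hp]; rfl
      · rw [show p' = (0 : Fin (m + 1)).succ.succ from Fin.ext hp]; simp; rfl
      · have : ∃ i' : Fin (m + 1), p' = i'.succ.succ ∧ (i' : ℕ) = i + 1 := by
          have := p'.is_lt
          simp at hp
          exact ⟨⟨i + 1, by omega⟩, Fin.ext (by simp [hp]), rfl⟩
        obtain ⟨i', rfl, hi'⟩ := this
        have h0 : i' ≠ 0 := by rintro rfl; simp at hi'
        simpa [h0] using comp_arcBot σ hi'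
    · rcases Fin.eq_zero_or_eq_succ q with rfl | ⟨r, rfl⟩
      · rw [show q' = (0 : Fin (m + 2)).succ from Fin.ext hq, ← hz]
        simp only [Fin.cases_zero, Fin.cases_succ, Fin.insertNth_apply_succAbove]
        rfl
      · rcases Fin.eq_self_or_eq_succAbove a.castSucc r with rfl | ⟨j, rfl⟩
        · rw [show q' = a.succ.succ from Fin.ext (by simp [hq])]; simp
        · have : ∃ j' : Fin (m + 1), (j' : ℕ) = j + 1 := by
            have := q'.is_lt
            have := j.is_le
            refine ⟨⟨j + 1, ?_⟩, rfl⟩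
            by_contra hlt
            rw [show j = Fin.last m from Fin.ext (by simp; omega), hlast] at hq
            simp at hq; omega
          obtain ⟨j', hj'⟩ := this
          rw [show q' = (a.succ.succAbove j').succ from
            Fin.ext (by rw [hq, Fin.val_succ, Fin.val_succ, hup hj'])]
          simpa using comp_arcTop σ hj'
    · rw [← Fin.succ_last, ← hlast]
      simp only [Fin.cases_zero, Fin.cases_succ, Fin.insertNth_apply_succAbove]
      exact comp_mark σ rfl rfl)
  -- the diagram of `σ` inside that of `T σ`
  obtain ⟨F, hF⟩ := exists_comp_map (σ := σ) (φ := fun x => match x with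
    | .botBlack i => if i = 0 then comp τ (.botBlack 0) else comp τ (.botBlack i.succ.succ)
    | .botWhite i => comp τ (.botWhite i.succ.succ)
    | .topBlack j => comp τ (.topBlack (a.succ.succAbove j).succ)
    | .topWhite j => comp τ (.topWhite (a.castSucc.succAbove j).succ)) (by
    refine link_cases (fun i => ?_) (fun i => ?_) (fun i j hij => ?_) (fun i j hij => ?_) ?_
    · dsimp only
      split_ifs with hi
      · rw [hi, ← ha, haa]; exact comp_edgeBW τ τ0
      · exact comp_edgeBW τ (by rw [τi, hne (by rw [ha, σ.injective.ne_iff]; exact hi)])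
    · exact comp_edgeWB τ (τi i)
    · dsimp only
      rw [if_neg (by rintro rfl; simp at hij)]
      exact comp_arcBot τ (by simp [hij])
    · exact comp_arcTop τ (by rw [Fin.val_succ, Fin.val_succ, hup hij])
    · simp only [if_true, hlast]
      exact comp_mark τ rfl rfl)
  -- These links form the initial detour of the rank path of `T σ`. It uses two top arcs and then
  -- enters the copy of the rank path of `σ`.
  have c1 : comp τ (.topBlack 0) = comp τ (.botWhite 1) := (comp_edgeWB τ τ1).symm
  have c2 : comp τ (.botWhite 1) = comp τ (.botBlack (0 : Fin (m + 1)).succ.succ) :=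
    comp_arcBot τ rfl
  have c3 : comp τ (.botBlack (0 : Fin (m + 1)).succ.succ) = comp τ (.topWhite a.castSucc.succ) :=
    comp_edgeBW τ (by rw [τi, ← ha, haa'])
  have c4 : comp τ (.topWhite a.castSucc.succ) = comp τ (.topBlack a.succ.succ) :=
    comp_arcTop τ (by simp)
  have c5 : comp τ (.topBlack a.succ.succ) = comp τ (.botWhite 0) := (comp_edgeWB τ τ0).symm
  have c6 : comp τ (.botWhite 0) = comp τ (.botBlack 1) := comp_arcBot τ rfl
  have c7 : comp τ (.botBlack 1) = comp τ (.topWhite 0) := comp_edgeBW τ τ1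
  have c8 : comp τ (.topWhite 0) = F (comp σ (.topBlack 0)) := by
    rw [hF]; exact comp_arcTop τ (by simp [hz])
  have hGF : ∀ c, G (F c) = c := by
    intro c
    obtain ⟨x, rfl⟩ := comp_surjective σ c
    rw [hF]
    cases x with
    | botBlack i =>
      dsimp only
      split_ifs with hi
      · rw [hG, hi]; rfl
      · rw [hG]; simp [hi]
    | botWhite i => rw [hG]; simp
    | topBlack j => rw [hG]; simp
    | topWhite j => rw [hG]; simp
  refine ⟨F, ⟨Function.LeftInverse.injective hGF, fun c => ?_⟩, ?_, fun j => by rw [hF]; rfl, ?_⟩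
  · obtain ⟨y, rfl⟩ := comp_surjective τ c
    have hr : ∃ c, F c = comp τ (.topWhite 0) := ⟨_, c8.symm⟩
    cases y with
    | botBlack p =>
      rcases fin_cases_two (p := p) with rfl | rfl | ⟨i, rfl⟩
      · exact ⟨comp σ (.botBlack 0), by rw [hF]; simp⟩
      · rwa [c7]
      · by_cases hi : i = 0
        · rwa [hi, c3, c4, c5, c6, c7]
        · exact ⟨comp σ (.botBlack i), by rw [hF]; simp [hi]⟩
    | botWhite p =>
      rcases fin_cases_two (p := p) with rfl | rfl | ⟨i, rfl⟩
      · rwa [c6, c7]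
      · rwa [c2, c3, c4, c5, c6, c7]
      · exact ⟨comp σ (.botWhite i), by rw [hF]⟩
    | topBlack q =>
      rcases Fin.eq_zero_or_eq_succ q with rfl | ⟨r, rfl⟩
      · rwa [c1, c2, c3, c4, c5, c6, c7]
      · rcases Fin.eq_self_or_eq_succAbove a.succ r with rfl | ⟨j, rfl⟩
        · rwa [c5, c6, c7]
        · exact ⟨comp σ (.topBlack j), by rw [hF]⟩
    | topWhite q =>
      rcases Fin.eq_zero_or_eq_succ q with rfl | ⟨r, rfl⟩
      · exact hr
      · rcases Fin.eq_self_or_eq_succAbove a.castSucc r with rfl | ⟨j, rfl⟩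
        · rwa [c4, c5, c6, c7]
        · exact ⟨comp σ (.topWhite j), by rw [hF]⟩
  · exact (c1.trans (c2.trans (c3.trans (c4.trans (c5.trans (c6.trans (c7.trans c8))))))).symm
  · exact (c1.trans (c2.trans (c3.trans c4))).symm

theorem cycleStructure_opT (σ : Perm (Fin (m + 1))) :
    cycleStructure (opT σ) = cycleStructure σ := by
  obtain ⟨F, hF, h0, h1, h2⟩ := exists_comp_bijective_opT σ
  refine cycleStructure_eq_of_bijective hF h0 fun c hc => ?_
  rw [pathLength_eq, pathLength_eq, ← Set.ncard_image_of_injective _ (shiftTop_injective σ)]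
  congr 1
  ext q
  simp only [Set.mem_image, Set.mem_ofPred_eq]
  constructor
  · rintro ⟨hq, hqc⟩
    obtain ⟨r, rfl⟩ := Fin.exists_succ_eq.2 hq
    rcases Fin.eq_self_or_eq_succAbove (σ 0).succ r with rfl | ⟨j, rfl⟩
    · rw [h2, ← h0, hF.1.eq_iff] at hqc
      exact absurd hqc.symm hc
    · have := (h1 j).symm.trans hqc
      rw [hF.1.eq_iff] at this
      exact ⟨j, ⟨by rintro rfl; exact hc this.symm, this⟩, rfl⟩
  · rintro ⟨j, ⟨-, hj⟩, rfl⟩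
    exact ⟨Fin.succ_ne_zero _, by rw [h1, hj]⟩

theorem rank_opT (σ : Perm (Fin (m + 1))) : rank (opT σ) = rank σ + 2 := by
  obtain ⟨F, hF, h0, h1, h2⟩ := exists_comp_bijective_opT σ
  -- The two added points are the right ends of the arcs of the detour.
  have hset : {q : Fin (m + 3) | q ≠ 0 ∧ comp (opT σ) (.topBlack q) = rankPath (opT σ)} =
      insert (σ 0).succ.succ (insert (shiftTop σ 0) (shiftTop σ ''
        {j : Fin (m + 1) | j ≠ 0 ∧ comp σ (.topBlack j) = rankPath σ})) := by
    ext q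
    simp only [Set.mem_insert_iff, Set.mem_image, Set.mem_ofPred_eq]
    constructor
    · rintro ⟨hq, hqc⟩
      obtain ⟨r, rfl⟩ := Fin.exists_succ_eq.2 hq
      rcases Fin.eq_self_or_eq_succAbove (σ 0).succ r with rfl | ⟨j, rfl⟩
      · exact Or.inl rfl
      · right
        have := (h1 j).symm.trans hqc
        rw [← h0, hF.1.eq_iff] at this
        by_cases hj : j = 0
        · exact Or.inl (by rw [hj]; rfl)
        · exact Or.inr ⟨j, ⟨hj, this⟩, rfl⟩
    · rintro (rfl | rfl | ⟨j, ⟨-, hj⟩, rfl⟩)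
      · exact ⟨Fin.succ_ne_zero _, h2⟩
      · exact ⟨Fin.succ_ne_zero _, by rw [h1, ← h0]; rfl⟩
      · exact ⟨Fin.succ_ne_zero _, by rw [h1, hj, h0]⟩
  have hne : ∀ j, shiftTop σ j ≠ (σ 0).succ.succ := fun j h =>
    Fin.succAbove_ne _ _ (Fin.succ_injective _ h)
  rw [rank, rank, pathLength_eq, pathLength_eq, hset, Set.ncard_insert_of_notMem,
    Set.ncard_insert_of_notMem, Set.ncard_image_of_injective _ (shiftTop_injective σ)]
  · rintro ⟨j, ⟨hj, -⟩, h⟩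
    exact hj (shiftTop_injective σ h)
  · rintro (h | ⟨j, -, h⟩)
    exacts [hne _ h.symm, hne _ h]

/-! ### Permutations of large rank -/

/-- If the rank is larger than `2`, then the rank path does not end at one of the first two edges
on it, nor at the next one. -/
theorem exists_follows_of_rank {σ : Perm (Fin (m + 1))} {s : Labelled m} (hσ : s.perm = σ)
    {o b : Fin (m + 1)} (hb : s.IsNormal o b) (hr : 2 < rank σ) :
    ∃ t f, s.Follows o t ∧ s.Follows t f ∧ s.pos f ≠ m := by
  obtain ⟨b1, b2, b3, b4⟩ := hb
  have hm : 3 ≤ m := by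
    have : rank σ ≤ (Set.univ : Set (Fin m)).ncard := Set.ncard_le_ncard (Set.subset_univ _)
    rw [Set.ncard_univ, Nat.card_fin] at this
    omega
  -- A set of endpoints that is closed under links and contains the top-left one contains the rank
  -- path. If it has at most two further black top points, the rank is at most `2`.
  have bound : ∀ A : Endpoint (m + 1) → Prop, A (.topBlack 0) →
      (∀ x y, Link σ x y → A x = A y) → ∀ u v : Fin (m + 1),
      (∀ j, A (.topBlack j) → j = 0 ∨ j = u ∨ j = v) → False := by
    intro A h0 hA u v huv
    have : rank σ ≤ ({u, v} : Set (Fin (m + 1))).ncard := by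
      rw [rank, pathLength_eq]
      refine Set.ncard_le_ncard ?_
      rintro j ⟨hj, hjc⟩
      have : A (.topBlack j) = A (.topBlack 0) :=
        eq_of_comp_eq (φ := A) (hA) hjc
      rcases huv j (this ▸ h0) with h | h | h
      · exact absurd h hj
      · exact Or.inl h
      · exact Or.inr h
    have h2 := Set.ncard_insert_le u {v}
    rw [Set.ncard_singleton] at h2
    omega
  have key : ∀ e p : Fin (m + 1), (p : ℕ) = s.pos e ↔ (σ p : ℕ) = s.val e := by
    intro e p
    obtain ⟨e', rfl⟩ := s.1.surjective p
    rw [← hσ, s.perm_apply]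
    exact s.pos_inj.trans s.val_inj.symm
  obtain ⟨t, ht⟩ := s.exists_val_eq (k := 2) (by omega)
  have hot : s.Follows o t := ⟨b, by omega, Or.inl (by omega)⟩
  have ko := key o
  have kb := key b
  have kt := key t
  rw [b1, b2] at ko
  rw [b3, b4] at kb
  rw [ht] at kt
  have pt : 1 < s.pos t := by
    by_contra hlt
    have : s.pos t = s.pos o ∨ s.pos t = s.pos b := by omega
    rcases this with h | h <;> rw [s.pos_inj] at h <;> subst h <;> omega
  by_cases htm : s.pos t = m
  · rw [htm] at kt
    -- If `t` is last at the bottom, the rank path ends there, and these are all its endpoints.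
    refine (bound (fun x => match x with
      | .topBlack j => (j : ℕ) = 0 ∨ (j : ℕ) = 2
      | .botWhite p => (p : ℕ) = 0 ∨ (p : ℕ) = m
      | .botBlack p => (p : ℕ) = 1
      | .topWhite q => (q : ℕ) = 1) (Or.inl rfl) ?_ (s.2 t) (s.2 t)
      fun j hj => ?_).elim
    · refine link_cases (fun p => ?_) (fun p => ?_) (fun p p' hp => ?_) (fun q q' hq => ?_) ?_
      · exact propext (kb p)
      · exact propext (or_congr (ko p) (kt p))
      · have := p'.is_le
        exact propext (by dsimp only; omega)
      · exact propext (by dsimp only; omega)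
      · exact propext (by simp only [Fin.val_last, Fin.val_zero]; omega)
    · rcases hj with hj | hj
      · exact Or.inl (Fin.ext hj)
      · exact Or.inr (Or.inl (Fin.ext (hj.trans ht.symm)))
  · have := s.pos_le t
    obtain ⟨x, hx⟩ := s.exists_pos_eq (k := s.pos t + 1) (by omega)
    by_cases hxm : s.val x = m
    · exact ⟨t, b, hot, ⟨x, hx, Or.inr ⟨hxm, o, b1, by omega⟩⟩, by omega⟩
    have hxl := s.val_le x
    obtain ⟨f, hf⟩ := s.exists_val_eq (k := s.val x + 1) (by omega)
    refine ⟨t, f, hot, ⟨x, hx, Or.inl hf⟩, fun hfm => ?_⟩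
    have kx := key x
    have kf := key f
    rw [hx] at kx
    rw [hfm, hf] at kf
    -- These are the endpoints of the rank path if it ends at `f`, after two top arcs.
    refine (bound (fun y => match y with
      | .topBlack j => (j : ℕ) = 0 ∨ (j : ℕ) = 2 ∨ (j : ℕ) = s.val x + 1
      | .botWhite p => (p : ℕ) = 0 ∨ (p : ℕ) = s.pos t ∨ (p : ℕ) = m
      | .botBlack p => (p : ℕ) = 1 ∨ (p : ℕ) = s.pos t + 1
      | .topWhite q => (q : ℕ) = 1 ∨ (q : ℕ) = s.val x) (Or.inl rfl)
      ?_ (s.2 t) (s.2 f) fun j hj => ?_).elim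
    · refine link_cases (fun p => ?_) (fun p => ?_) (fun p p' hp => ?_) (fun q q' hq => ?_) ?_
      · exact propext (or_congr (kb p) (kx p))
      · exact propext (or_congr (ko p) (or_congr (kt p) (kf p)))
      · have := p'.is_le
        exact propext (by dsimp only; omega)
      · exact propext (by dsimp only; omega)
      · exact propext (by simp only [Fin.val_last, Fin.val_zero]; omega)
    · rcases hj with hj | hj | hj
      · exact Or.inl (Fin.ext hj)
      · exact Or.inr (Or.inl (Fin.ext (hj.trans ht.symm)))
      · exact Or.inr (Or.inr (Fin.ext (hj.trans hf.symm)))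

end Rauzy

namespace Rauzy
open Equiv Finset

/-! ### The Arf invariant -/

/-- `W` is the exponential of a quadratic form on the subsets of `E`, with the value `-1` on all
one-element sets and with the polar form `ε`. -/
structure IsQuadratic {E : Type*} [DecidableEq E] (W : Finset E → ℤ) (ε : E → E → ℤ) : Prop where
  empty : W ∅ = 1
  insert : ∀ a I, a ∉ I → W (insert a I) = -W I * ∏ y ∈ I, ε a y

theorem IsQuadratic.eq_of_agree {E : Type*} [DecidableEq E] {W W' : Finset E → ℤ}
    {ε ε' : E → E → ℤ} (hW : IsQuadratic W ε) (hW' : IsQuadratic W' ε') {S : Finset E}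
    (h : ∀ x ∈ S, ∀ y ∈ S, x ≠ y → ε' x y = ε x y) {I : Finset E} (hI : I ⊆ S) : W' I = W I := by
  induction I using Finset.induction_on with
  | empty => rw [hW.empty, hW'.empty]
  | insert a I ha ih =>
    rw [hW.insert a I ha, hW'.insert a I ha, ih ((subset_insert a I).trans hI)]
    congr 1
    refine prod_congr rfl fun y hy => h a (hI (mem_insert_self a I)) y
      (hI (mem_insert_of_mem hy)) ?_
    rintro rfl
    exact ha hy

/-- The sum of the exponential of a quadratic form does not change if one basis vector `h` is
replaced by `h + o`. -/
theorem IsQuadratic.sum_eq {E : Type*} [DecidableEq E] [Fintype E] {W W' : Finset E → ℤ}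
    {ε ε' : E → E → ℤ} (hW : IsQuadratic W ε) (hW' : IsQuadratic W' ε') {h o : E} (hne : h ≠ o)
    (h1 : ∀ x y, x ≠ h → y ≠ h → x ≠ y → ε' x y = ε x y) (h2 : ε h o = -1) (h3 : ε' h o = -1)
    (h4 : ∀ y, y ≠ h → y ≠ o → ε' h y = ε h y * ε o y) (h5 : ∀ x y, ε x y * ε x y = 1) :
    ∑ I, W' I = ∑ I, W I := by
  have huniv : (univ : Finset (Finset E)) =
      (Insert.insert h (Insert.insert o ((univ.erase h).erase o))).powerset := by
    rw [insert_erase (by simp [hne.symm]), insert_erase (mem_univ h), powerset_univ]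
  have ho : o ∉ (univ.erase h).erase o := by simp
  have hh : h ∉ Insert.insert o ((univ.erase h).erase o) := by simp [hne]
  rw [huniv, sum_powerset_insert hh, sum_powerset_insert ho, sum_powerset_insert ho,
    sum_powerset_insert hh, sum_powerset_insert ho, sum_powerset_insert ho, ← sum_add_distrib,
    ← sum_add_distrib, ← sum_add_distrib, ← sum_add_distrib, ← sum_add_distrib,
    ← sum_add_distrib]
  refine sum_congr rfl fun J hJ => ?_
  rw [mem_powerset] at hJ
  have hoJ : o ∉ J := fun h => ho (hJ h)
  have hhJ : h ∉ J := fun h => hh (mem_insert_of_mem (hJ h))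
  have hhoJ : h ∉ Insert.insert o J := by simp [hne, hhJ]
  have agree : ∀ I : Finset E, h ∉ I → W' I = W I := fun I hI =>
    hW.eq_of_agree hW' (S := I) (fun x hx y hy hxy =>
      h1 x y (by rintro rfl; exact hI hx) (by rintro rfl; exact hI hy) hxy) (Subset.refl I)
  have hprod : ∏ y ∈ J, ε' h y = (∏ y ∈ J, ε h y) * ∏ y ∈ J, ε o y := by
    rw [← prod_mul_distrib]
    exact prod_congr rfl fun y hy => h4 y (by rintro rfl; exact hhJ hy)
      (by rintro rfl; exact hoJ hy)
  have hsq : (∏ y ∈ J, ε o y) * ∏ y ∈ J, ε o y = 1 := by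
    rw [← prod_mul_distrib]
    exact prod_eq_one fun y _ => h5 o y
  -- For `J` without `h` and `o`, the new terms at `J + h` and `J + h + o` are the old terms at `J +
  -- h + o` and `J + h`.
  rw [hW'.insert h _ hhoJ, hW'.insert h J hhJ, hW.insert h _ hhoJ, hW.insert h J hhJ,
    agree _ hhoJ, agree J hhJ, hW.insert o J hoJ, prod_insert hoJ, prod_insert hoJ, h2, h3, hprod]
  linear_combination (W J * (∏ y ∈ J, ε h y)) * (-hsq)

variable {m : ℕ}

/-- The summands of the Arf invariant. -/
def arfTerm (σ : Perm (Fin (m + 1))) (I : Finset (Fin (m + 1))) : ℤ :=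
  (-1) ^ (I.card + nonCrossings σ I)

/-- The sign of a pair of edges is `-1` if they do not cross. -/
def crossSign (σ : Perm (Fin (m + 1))) (x y : Fin (m + 1)) : ℤ :=
  if x < y ∧ σ x < σ y ∨ y < x ∧ σ y < σ x then -1 else 1

theorem crossSign_mul_self (σ : Perm (Fin (m + 1))) (x y : Fin (m + 1)) :
    crossSign σ x y * crossSign σ x y = 1 := by
  rw [crossSign]; split_ifs <;> rfl

theorem isQuadratic_arfTerm (σ : Perm (Fin (m + 1))) :
    IsQuadratic (arfTerm σ) (crossSign σ) := by
  refine ⟨by simp [arfTerm, nonCrossings], fun a I ha => ?_⟩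
  have hN : ∀ I, nonCrossings σ I = ∑ x ∈ I, ∑ y ∈ I, if x < y ∧ σ x < σ y then 1 else 0 := by
    intro I
    rw [nonCrossings, card_filter, sum_product]
  have hs : ∀ y, crossSign σ a y = (-1) ^ ((if a < y ∧ σ a < σ y then 1 else 0) +
      if y < a ∧ σ y < σ a then 1 else 0) := by
    intro y
    rw [crossSign]
    by_cases h1 : a < y ∧ σ a < σ y
    · rw [if_pos (Or.inl h1), if_pos h1, if_neg fun h => h1.1.asymm h.1]; rfl
    · by_cases h2 : y < a ∧ σ y < σ a
      · rw [if_pos (Or.inr h2), if_neg h1, if_pos h2]; rfl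
      · rw [if_neg (not_or.2 ⟨h1, h2⟩), if_neg h1, if_neg h2]; rfl
  simp only [arfTerm, hN, hs]
  rw [card_insert_of_notMem ha, prod_pow_eq_pow_sum, sum_insert ha, sum_insert ha, if_neg (by simp)]
  simp only [sum_insert ha, sum_add_distrib]
  ring

theorem arf_eq_sum (σ : Perm (Fin (m + 1))) : arf σ = ∑ I, arfTerm σ I := rfl

theorem crossSign_eq_neg_one {σ : Perm (Fin (m + 1))} {x y : Fin (m + 1)} (h : x < y)
    (h' : σ x < σ y) : crossSign σ x y = -1 :=
  if_pos (Or.inl ⟨h, h'⟩)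

/-- `L` moves the top end of the last edge `k` next to that of the first edge. For the quadratic
form this replaces the basis vector of `k` by its sum with that of `0`; all other pairs of edges
cross as before. -/
theorem arf_opL (σ : Perm (Fin (m + 1))) : arf (opL σ) = arf σ := by
  obtain ⟨k, hk⟩ := σ.surjective (Fin.last m)
  have hv := opL_val σ
  have hkm : (σ k : ℕ) = m := by rw [hk, Fin.val_last]
  by_cases h0 : k = 0
  · have : opL σ = σ := by
      ext i
      rw [hv, if_pos (by rw [← h0, hkm]; exact (σ i).is_le)]
    rw [this]
  have h0' : (0 : Fin (m + 1)) < k := Fin.pos_of_ne_zero h0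
  have hne : ∀ {x y}, x ≠ y → (σ x : ℕ) ≠ σ y := fun h h' => h (σ.injective (Fin.ext h'))
  have hle : ∀ x, (σ x : ℕ) ≤ m := fun x => (σ x).is_le
  have hk0 := hne h0
  have hk1 := hle 0
  have ek : (opL σ k : ℕ) = σ 0 + 1 := by rw [hv, if_neg (by omega), if_pos hkm]
  have ey : ∀ y, y ≠ k → (opL σ y : ℕ) = if (σ y : ℕ) ≤ σ 0 then (σ y : ℕ) else σ y + 1 := by
    intro y hy
    have := hne hy
    rw [hv]
    split_ifs <;> omega
  refine (isQuadratic_arfTerm σ).sum_eq (isQuadratic_arfTerm (opL σ)) h0 ?_ ?_ ?_ ?_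
    (crossSign_mul_self σ)
  · intro x y hx hy _
    simp only [crossSign, Fin.lt_def, ey x hx, ey y hy]
    congr 1
    refine propext (or_congr (and_congr_right fun _ => ?_) (and_congr_right fun _ => ?_)) <;>
      split_ifs <;> omega
  · exact if_pos (Or.inr ⟨h0', Fin.lt_def.2 (by omega)⟩)
  · exact if_pos (Or.inr ⟨h0', Fin.lt_def.2 (by rw [opL_zero]; omega)⟩)
  · intro y hyk hy0
    have hy0' : (0 : Fin (m + 1)) < y := Fin.pos_of_ne_zero hy0
    have a1 := hne hyk
    have a2 := hne hy0
    have a3 := hle y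
    have e1 := ey y hyk
    rw [Fin.lt_def] at hy0' h0'
    have a4 : (y : ℕ) ≠ k := fun h => hyk (Fin.ext h)
    simp only [crossSign, Fin.lt_def, ek, e1, Fin.val_zero]
    rcases lt_or_gt_of_ne a2 with h | h
    · rw [if_pos h.le]
      split_ifs <;> first | rfl | omega
    · rw [if_neg (not_le.2 h)]
      split_ifs <;> first | rfl | omega

/-- Here the first edge moves next to the edge `k`, so the basis vector of `0` is replaced by its
sum with that of `k`. -/
theorem arf_opR (σ : Perm (Fin (m + 1))) : arf (opR σ) = arf σ := by
  obtain ⟨k, hk⟩ := σ.surjective (Fin.last m)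
  have hk' : σ⁻¹ (Fin.last m) = k := by rw [← hk]; simp
  have hkm : (σ k : ℕ) = m := by rw [hk, Fin.val_last]
  set γ := gammaL k with hγ
  have hv : ∀ j, (γ j : ℕ) = if (k : ℕ) ≤ j then (j : ℕ) else
      if (j : ℕ) = 0 then (k : ℕ) - 1 else (j : ℕ) - 1 := gammaL_val _
  have hR : ∀ x, opR σ (γ x) = σ x := fun x => by simp [opR, hk', ← hγ]
  by_cases h0 : k = 0
  · have : γ = 1 := by
      ext i
      rw [hv, h0, if_pos (by simp)]
      rfl
    rw [opR, hk', ← hγ, this, inv_one, mul_one]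
  have hne : ∀ {x y}, x ≠ y → (σ x : ℕ) ≠ σ y := fun h h' => h (σ.injective (Fin.ext h'))
  have hle : ∀ x, (σ x : ℕ) ≤ m := fun x => (σ x).is_le
  have hk0 := hne h0
  have hk1 := hle 0
  have h0' : 0 < (k : ℕ) := Fin.pos_of_ne_zero h0
  have g0 : (γ 0 : ℕ) = k - 1 := by
    rw [hv, if_neg (by rw [Fin.val_zero]; omega), if_pos (by simp)]
  have gk : (γ k : ℕ) = k := by rw [hv, if_pos le_rfl]
  -- Since `R` renumbers the bottom points, the new form is pulled back along `γ` to the old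
  -- numbering of the edges.
  have hW : IsQuadratic (fun I => arfTerm (opR σ) (I.map γ.toEmbedding))
      (fun x y => crossSign (opR σ) (γ x) (γ y)) := by
    refine ⟨(isQuadratic_arfTerm _).empty, fun a I ha => ?_⟩
    rw [map_insert, (isQuadratic_arfTerm _).insert _ _ (by simpa using ha), prod_map]
    rfl
  have hsum : arf (opR σ) = ∑ I : Finset (Fin (m + 1)), arfTerm (opR σ) (I.map γ.toEmbedding) :=
    (Equiv.sum_comp (Equiv.finsetCongr γ) _).symm
  rw [hsum]
  refine (isQuadratic_arfTerm σ).sum_eq hW (Ne.symm h0) ?_ ?_ ?_ ?_ (crossSign_mul_self σ)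
  · intro x y hx hy _
    have hx' : 0 < (x : ℕ) := Fin.pos_of_ne_zero hx
    have hy' : 0 < (y : ℕ) := Fin.pos_of_ne_zero hy
    simp only [crossSign, Fin.lt_def, hR, hv]
    congr 1
    refine propext (or_congr (and_congr_left fun _ => ?_) (and_congr_left fun _ => ?_)) <;>
      split_ifs <;> omega
  · exact if_pos (Or.inl ⟨h0', Fin.lt_def.2 (by omega)⟩)
  · refine if_pos (Or.inl ⟨Fin.lt_def.2 (by omega), ?_⟩)
    rw [hR, hR]
    exact Fin.lt_def.2 (by omega)
  · intro y hy0 hyk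
    have hy0' : 0 < (y : ℕ) := Fin.pos_of_ne_zero hy0
    have a1 := hne hyk
    have a2 := hne hy0
    have a3 := hle y
    have a4 : (y : ℕ) ≠ k := fun h => hyk (Fin.ext h)
    have gy := hv y
    simp only [crossSign, Fin.lt_def, hR, g0, Fin.val_zero]
    rcases lt_or_gt_of_ne a4 with h | h
    · rw [if_neg (by omega), if_neg (by omega)] at gy
      rw [gy]
      split_ifs <;> first | rfl | omega
    · rw [if_pos (by omega)] at gy
      rw [gy]
      split_ifs <;> first | rfl | omega

theorem arf_eq_of_connected {σ τ : Perm (Fin (m + 1))} (h : Connected σ τ) : arf τ = arf σ := by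
  induction h with
  | refl => rfl
  | tail _ h ih =>
    rcases h with rfl | rfl
    exacts [(arf_opL _).trans ih, (arf_opR _).trans ih]

theorem invariant_eq_of_connected {σ τ : Perm (Fin (m + 1))} (h : Connected σ τ) :
    invariant τ = invariant σ := by
  obtain ⟨h1, h2⟩ := cycleStructure_rank_eq h
  rw [invariant, invariant, h1, h2, arf_eq_of_connected h]

/-- The new edge `1` crosses `0` and no other edge, so summing over its membership leaves the factor
`1 - (-1) ^ |J|`. The edge `0` has the same signs as the copy of the first edge of `σ` with all
remaining edges. Pairing `J` with `J ∪ {0}` therefore combines the factors for even and odd size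
into `2`. -/
theorem arf_opT (σ : Perm (Fin (m + 1))) : arf (opT σ) = 2 * arf σ := by
  set τ := opT σ with hτ
  let ι : Fin (m + 1) ↪ Fin (m + 3) := (Fin.succEmb (m + 1)).trans (Fin.succEmb (m + 2))
  have hι : ∀ i, ι i = i.succ.succ := fun _ => rfl
  have t0 : (τ 0 : ℕ) = σ 0 + 2 := opT_zero σ
  have t1 : τ 1 = 0 := opT_one σ
  have ti : ∀ i, (τ (ι i) : ℕ) = if (σ i : ℕ) ≤ σ 0 then (σ i : ℕ) + 1 else (σ i : ℕ) + 2 :=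
    fun i => opT_val σ (by simp [hι])
  have hQ := isQuadratic_arfTerm σ
  have hT := isQuadratic_arfTerm τ
  have v0 : ((0 : Fin (m + 3)) : ℕ) = 0 := rfl
  have v1 : ((1 : Fin (m + 3)) : ℕ) = 1 := rfl
  have vi : ∀ i, (ι i : ℕ) = i + 2 := fun i => by simp [hι]
  have s1 : ∀ i, crossSign τ 1 (ι i) = -1 := fun i =>
    crossSign_eq_neg_one (Fin.lt_def.2 (by rw [v1, vi]; omega))
      (Fin.lt_def.2 (by rw [t1, ti, Fin.val_zero]; split_ifs <;> omega))
  have s2 : crossSign τ 1 0 = 1 := if_neg (by simp only [Fin.lt_def, v0, v1, t0, t1]; omega)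
  have s3 : ∀ i j, crossSign τ (ι i) (ι j) = crossSign σ i j := by
    intro i j
    simp only [crossSign, Fin.lt_def, vi, ti]
    congr 1
    refine propext (or_congr (and_congr (by omega) ?_) (and_congr (by omega) ?_)) <;>
      split_ifs <;> omega
  have s4 : ∀ i, i ≠ 0 → crossSign τ 0 (ι i) = crossSign σ 0 i := by
    intro i hi
    have h1 : (σ i : ℕ) ≠ σ 0 := fun h => hi (σ.injective (Fin.ext h))
    have h2 : 0 < (i : ℕ) := Fin.pos_of_ne_zero hi
    simp only [crossSign, Fin.lt_def, vi, ti, v0, t0, Fin.val_zero]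
    congr 1
    refine propext (or_congr (and_congr (by omega) ?_) (and_congr (by omega) ?_)) <;>
      split_ifs <;> omega
  have s5 : crossSign τ 0 (ι 0) = 1 := by
    refine if_neg ?_
    simp only [Fin.lt_def, vi, ti, v0, t0, if_pos le_rfl]
    omega
  have hemb : ∀ J : Finset (Fin (m + 1)), arfTerm τ (J.map ι) = arfTerm σ J := by
    intro J
    induction J using Finset.induction_on with
    | empty => rw [map_empty, hQ.empty, hT.empty]
    | insert a J ha ih =>
      rw [map_insert, hT.insert _ _ (by simpa using ha), hQ.insert _ _ ha, ih, prod_map]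
      simp only [s3]
  have huniv : (univ : Finset (Finset (Fin (m + 3)))) =
      (Insert.insert 1 (Insert.insert 0 (univ.map ι))).powerset := by
    rw [← powerset_univ]
    congr 1
    ext p
    simp only [mem_univ, mem_insert, mem_map, true_and, true_iff]
    rcases fin_cases_two (p := p) with h | h | ⟨i, h⟩
    · exact Or.inr (Or.inl h)
    · exact Or.inl h
    · exact Or.inr (Or.inr ⟨i, h.symm⟩)
  have n0 : ∀ J : Finset (Fin (m + 1)), (0 : Fin (m + 3)) ∉ J.map ι := fun J h => by
    obtain ⟨i, -, hi⟩ := mem_map.1 h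
    exact Fin.succ_ne_zero _ hi
  have n1 : ∀ J : Finset (Fin (m + 1)),
      (1 : Fin (m + 3)) ∉ Insert.insert (0 : Fin (m + 3)) (J.map ι) := fun J h => by
    rcases mem_insert.1 h with h | h
    · exact absurd (congrArg Fin.val h) (by rw [v0, v1]; omega)
    · obtain ⟨i, -, hi⟩ := mem_map.1 h
      exact absurd (congrArg Fin.val hi) (by rw [v1, vi]; omega)
  have n1' : ∀ J : Finset (Fin (m + 1)), (1 : Fin (m + 3)) ∉ J.map ι := fun J h =>
    n1 J (mem_insert_of_mem h)
  have hpow : (univ.map ι).powerset = (univ : Finset (Finset (Fin (m + 1)))).map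
      (mapEmbedding ι).toEmbedding := by
    ext I
    simp only [mem_powerset, subset_map_iff, mem_map, mem_univ, true_and, subset_univ,
      RelEmbedding.coe_toEmbedding, mapEmbedding_apply, eq_comm]
  have hcol : (univ : Finset (Finset (Fin (m + 1)))) =
      (Insert.insert (0 : Fin (m + 1)) (univ.erase 0)).powerset := by
    rw [insert_erase (mem_univ _), powerset_univ]
  have hsum : ∀ G : Finset (Fin (m + 1)) → ℤ, ∑ J, G J =
      ∑ J ∈ (univ.erase 0).powerset, (G J + G (Insert.insert 0 J)) := fun G => by
    rw [hcol, sum_powerset_insert (notMem_erase _ _), ← sum_add_distrib]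
  have hterm : ∀ J : Finset (Fin (m + 1)), arfTerm τ (Insert.insert 0 (J.map ι)) =
      -arfTerm σ J * ∏ y ∈ J, crossSign τ 0 (ι y) := fun J => by
    rw [hT.insert _ _ (n0 J), hemb, prod_map]
  have hprod : ∀ J : Finset (Fin (m + 1)),
      ∏ y ∈ J.map ι, crossSign τ 1 y = (-1) ^ J.card := fun J => by
    rw [prod_map, prod_congr rfl fun i _ => s1 i, prod_const]
  have hsum' : arf τ = ∑ J : Finset (Fin (m + 1)),
      (arfTerm σ J + arfTerm τ (Insert.insert 0 (J.map ι))) * (1 - (-1) ^ J.card) := by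
    rw [arf_eq_sum, huniv, sum_powerset_insert (n1 univ), sum_powerset_insert (n0 univ),
      sum_powerset_insert (n0 univ), hpow, sum_map, sum_map, sum_map, sum_map,
      ← sum_add_distrib, ← sum_add_distrib, ← sum_add_distrib]
    refine sum_congr rfl fun J _ => ?_
    simp only [RelEmbedding.coe_toEmbedding, mapEmbedding_apply]
    rw [hT.insert 1 _ (n1 J), hT.insert 1 _ (n1' J), prod_insert (n0 J), hprod, s2, hemb]
    ring
  rw [hsum', hsum, arf_eq_sum, hsum, mul_sum]
  refine sum_congr rfl fun J hJ => ?_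
  have hJ0 : (0 : Fin (m + 1)) ∉ J := fun h => by simpa using mem_powerset.1 hJ h
  have hb : ∏ y ∈ J, crossSign τ 0 (ι y) = ∏ y ∈ J, crossSign σ 0 y :=
    prod_congr rfl fun y hy => s4 y (by rintro rfl; exact hJ0 hy)
  have hsq : (∏ y ∈ J, crossSign σ 0 y) * ∏ y ∈ J, crossSign σ 0 y = 1 := by
    rw [← prod_mul_distrib]
    exact prod_eq_one fun y _ => crossSign_mul_self σ 0 y
  rw [hterm, hterm, prod_insert hJ0, s5, hb, hQ.insert 0 J hJ0, card_insert_of_notMem hJ0]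
  linear_combination arfTerm σ J * (1 + (-1) ^ J.card) * hsq

end Rauzy

namespace Rauzy
open Equiv

variable {m : ℕ}

/-! ### The pullback of `T` -/

theorem connected_opT {σ τ : Perm (Fin (m + 1))} (h : Connected σ τ) :
    Connected (opT σ) (opT τ) := by
  induction h with
  | refl => exact Connected.refl _
  | tail _ h ih =>
    rcases h with rfl | rfl
    · rw [opT_opL]
      exact ih.trans (connected_opL _)
    · exact ih.trans (connected_opT_opR _)

/-- From a standard permutation one reaches a state in normal form. -/
theorem Labelled.exists_isNormal {τ : Perm (Fin (m + 1))} (h : τ 0 = 0) (hm : 1 ≤ m) :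
    ∃ s : Labelled m, ∃ o b, Connected τ s.perm ∧ s.IsNormal o b := by
  obtain ⟨s, hs, hp, hv⟩ := Labelled.exists_perm_eq τ
  have hv0 : s.val 0 = 0 := by rw [hv, h, Fin.val_zero]
  obtain ⟨b, hb⟩ := s.exists_pos_eq hm
  have hb0 : b ≠ 0 := by
    rintro rfl
    simp [hp] at hb
  have hvb : s.val b ≠ s.val 0 := fun h => hb0 (s.val_inj.1 h)
  obtain ⟨t, h1, h2, h3⟩ := s.exists_rotate_val_first (o := 0) (y := b) (by simp [hp]) (by omega)
  refine ⟨t, 0, b, hs ▸ h1.connected, ?_, ?_, ?_, ?_⟩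
  · simp [h2, hp]
  · rw [h3, if_pos le_rfl, hv0]
  · rw [h2, hb]
  · rw [h3, if_neg (by omega), if_pos le_rfl]
    omega

/-- If in normal form the second edge follows the first one in two steps, then the state can be
rotated to the image of a permutation under `T`. -/
theorem Labelled.IsNormal.exists_opT {s : Labelled (m + 2)} {o t f : Fin (m + 3)}
    (h : s.IsNormal o f) (ht : s.Follows o t) (hf : s.Follows t f) :
    ∃ ρ : Perm (Fin (m + 1)), ρ 0 = 0 ∧ Connected s.perm (opT ρ) := by
  obtain ⟨h1, h2, h3, h4⟩ := h
  obtain ⟨x, hx, hx'⟩ := ht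
  have hxf : s.pos x = s.pos f := by omega
  rw [s.pos_inj] at hxf
  subst hxf
  have ht2 : s.val t = 2 := by
    rcases hx' with h | h
    · omega
    · have := h.1
      omega
  clear hx'
  have hpt0 : s.pos t ≠ s.pos o := fun h => by
    rw [s.pos_inj] at h
    subst h
    omega
  have hpt1 : s.pos t ≠ s.pos x := fun h => by
    rw [s.pos_inj] at h
    subst h
    omega
  obtain ⟨w, hw, hw'⟩ := hf
  -- A direct step to the second edge would come from the top point of `o`, so the step from `t`
  -- passes through the mark: the right neighbour of `t` ends last at the top.
  have hwm : s.val w = m + 2 := by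
    rcases hw' with h | h
    · have : s.val w = s.val o := by omega
      rw [s.val_inj] at this
      subst this
      omega
    · exact h.1
  -- This neighbour permits the bottom rotation that puts `t`, `o` and the second edge in front,
  -- with the values `2, 0, 1`.
  obtain ⟨u, hu, hv, hp⟩ := s.exists_rotate_pos hwm (x := t) (by omega)
  have e0 : u.pos t = 0 := by
    rw [hp, if_neg (by omega), if_pos le_rfl, Nat.sub_self]
  have e1 : u.pos o = 1 := by
    rw [hp, if_neg (by omega), if_neg (by omega)]
    omega
  have e2 : u.pos x = 2 := by
    rw [hp, if_neg (by omega), if_neg (by omega)]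
    omega
  obtain ⟨ρ, hρ, hT⟩ := exists_opT_eq (τ := u.perm)
    (by rw [u.perm_val (e := t) (by rw [e0]; rfl), hv, ht2])
    (Fin.ext (by rw [u.perm_val (e := o) (by rw [e1]; rfl), hv, h2]; rfl))
    (by rw [u.perm_val (e := x) (by rw [e2]; rfl), hv, h4])
  exact ⟨ρ, hρ, hT ▸ hu.connected⟩

/-- A primitive class of rank larger than `2` that does not contain the identity contains an image
of a standard permutation under `T`. -/
theorem exists_connected_opT {σ : Perm (Fin (m + 3))} (hσ : IsIrreducible σ)
    (hprim : ∀ τ, Connected σ τ → IsPrimitive τ) (hone : ¬ Connected σ 1) (hr : 2 < rank σ) :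
    ∃ ρ : Perm (Fin (m + 1)), ρ 0 = 0 ∧ Connected σ (opT ρ) := by
  obtain ⟨τ, hστ, hτ⟩ := hσ.exists_standard
  obtain ⟨s, o, b, hs, hb⟩ := Labelled.exists_isNormal hτ (by omega)
  have hσs := hστ.trans hs
  obtain ⟨t, f, ht, hf, hfm⟩ := exists_follows_of_rank rfl hb
    (by rwa [(cycleStructure_rank_eq hσs).2])
  by_cases h : ∃ u, Labelled.Tracks s u ∧ u.IsNormal o f
  · obtain ⟨u, hu, hn⟩ := h
    obtain ⟨ρ, hρ, hc⟩ := hn.exists_opT (ht.of_tracks hu) (hf.of_tracks hu)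
    exact ⟨ρ, hρ, hσs.trans (hu.connected.trans hc)⟩
  · have hT : s.Trapped o t f :=
      ⟨ht, hf, hfm, fun u hu => hprim _ (hσs.trans hu.connected), fun u hu c hc hcf =>
        h ⟨u, hu, hcf ▸ hc⟩⟩
    exact absurd (hT.perm_eq_one hb ▸ hσs) hone

theorem invariant_opT (σ : Perm (Fin (m + 1))) :
    invariant (opT σ) =
      ((invariant σ).1, (invariant σ).2.1 + 2, (invariant σ).2.2) := by
  simp only [invariant, cycleStructure_opT, rank_opT, arf_opT, sign_mul]
  congr 2

/-- An irreducible permutation of size at least two does not send the first point to the last. In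
size one it does, and `T` gives the reducible permutation 3, 1, 2. -/
theorem IsIrreducible.opT {σ : Perm (Fin (m + 1))} (h : IsIrreducible σ) (hm : 1 ≤ m) :
    IsIrreducible (opT σ) := by
  refine opT_isIrreducible fun h0 => (not_isIrreducible_iff σ).2
    ⟨1, le_rfl, by omega, fun i => ?_⟩ h
  constructor
  · intro hi
    have : i = 0 := Fin.ext (by simpa using hi)
    subst this
    omega
  · intro hi
    have : i = 0 := σ.injective (Fin.ext (by have := (σ i).is_le; omega))
    subst this
    simp

/-! ### The induced map on classes -/

namespace RauzyClass

/-- The class of an irreducible permutation. -/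
def mk {σ : Perm (Fin (m + 1))} (h : IsIrreducible σ) : RauzyClass m := ⟨classOf σ, σ, h, rfl⟩

theorem mem_mk {σ τ : Perm (Fin (m + 1))} {h : IsIrreducible σ} :
    τ ∈ mk h ↔ Connected σ τ := Iff.rfl

theorem exists_mk_eq (C : RauzyClass m) :
    ∃ (σ : Perm (Fin (m + 1))) (h : IsIrreducible σ), mk h = C := by
  obtain ⟨_, σ, h, rfl⟩ := C
  exact ⟨σ, h, rfl⟩

theorem mk_eq_of_mem {C : RauzyClass m} {σ : Perm (Fin (m + 1))} {h : IsIrreducible σ}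
    (hσ : σ ∈ C) : mk h = C := by
  obtain ⟨τ, hτ, rfl⟩ := C.exists_mk_eq
  exact Subtype.ext (classOf_eq (mem_mk.1 hσ)).symm

theorem isIrreducible_of_mem {C : RauzyClass m} {σ : Perm (Fin (m + 1))} (hσ : σ ∈ C) :
    IsIrreducible σ := by
  obtain ⟨τ, hτ, rfl⟩ := C.exists_mk_eq
  exact hτ.of_connected hσ

theorem connected_of_mem {C : RauzyClass m} {σ τ : Perm (Fin (m + 1))} (hσ : σ ∈ C)
    (hτ : τ ∈ C) : Connected σ τ := by
  obtain ⟨ρ, hρ, rfl⟩ := C.exists_mk_eq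
  exact (mem_mk.1 hσ).symm.trans hτ

theorem exists_mem (C : RauzyClass m) : ∃ σ, σ ∈ C := by
  obtain ⟨σ, h, rfl⟩ := C.exists_mk_eq
  exact ⟨σ, Connected.refl σ⟩

theorem invariants_eq {C : RauzyClass m} {σ : Perm (Fin (m + 1))} (h : σ ∈ C) :
    C.invariants = {invariant σ} := by
  ext v
  constructor
  · rintro ⟨τ, hτ, rfl⟩
    exact invariant_eq_of_connected (connected_of_mem h hτ)
  · rintro rfl
    exact ⟨σ, h, rfl⟩

/-- The map of classes induced by the operator `T`. -/
noncomputable def opT (hm : 1 ≤ m) (B : RauzyClass m) : RauzyClass (m + 2) :=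
  mk ((isIrreducible_of_mem B.exists_mem.choose_spec).opT hm)

theorem opT_mem (hm : 1 ≤ m) {B : RauzyClass m} {σ : Perm (Fin (m + 1))} (h : σ ∈ B) :
    Rauzy.opT σ ∈ B.opT hm :=
  mem_mk.2 (connected_opT (connected_of_mem B.exists_mem.choose_spec h))

theorem opT_mk (hm : 1 ≤ m) {C : RauzyClass (m + 2)} {σ : Perm (Fin (m + 1))}
    {h : IsIrreducible σ} (hC : Rauzy.opT σ ∈ C) : (mk h).opT hm = C :=
  (mk_eq_of_mem (h := h.opT hm) (opT_mem hm (mem_mk.2 (Connected.refl σ)))).symm.trans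
    (mk_eq_of_mem hC)

/-- The map (λ, r, s) ↦ (λ, r + 2, s) is injective. One direction makes the map on equivalence
classes well defined, the other gives the pullback property. -/
theorem invariants_opT_eq_iff (hm : 1 ≤ m) (B B' : RauzyClass m) :
    (B.opT hm).invariants = (B'.opT hm).invariants ↔ B.invariants = B'.invariants := by
  obtain ⟨σ, hσ⟩ := B.exists_mem
  obtain ⟨τ, hτ⟩ := B'.exists_mem
  rw [invariants_eq hσ, invariants_eq hτ, invariants_eq (opT_mem hm hσ),
    invariants_eq (opT_mem hm hτ), Set.singleton_eq_singleton_iff, Set.singleton_eq_singleton_iff,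
    invariant_opT, invariant_opT]
  simp only [Prod.ext_iff, Nat.add_right_cancel_iff]

theorem exists_standard_opT_mem {C : RauzyClass (m + 2)} (hC : C ∈ targetClasses (m + 2)) :
    ∃ ρ : Perm (Fin (m + 1)), ρ 0 = 0 ∧ Rauzy.opT ρ ∈ C := by
  obtain ⟨σ, hσ, rfl⟩ := C.exists_mk_eq
  obtain ⟨h1, h2, h3⟩ := hC
  exact exists_connected_opT hσ h2 (fun h => h1 (Or.inl h)) (h3 σ (Connected.refl σ))

end RauzyClass

end Rauzy

theorem mainTheorem4 (m : ℕ) :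
    (∀ C ∈ Rauzy.targetClasses (m + 2),
      ∃ σ : Equiv.Perm (Fin (m + 1)), Rauzy.IsIrreducible σ ∧ Rauzy.opT σ ∈ C) ∧
    (1 ≤ m → ∃ Tbar : Rauzy.RauzyClass m → Rauzy.RauzyClass (m + 2),
      (∀ B : Rauzy.RauzyClass m, ∀ σ ∈ B, Rauzy.opT σ ∈ Tbar B) ∧
      Set.SurjOn Tbar {B | B.Primitive} (Rauzy.targetClasses (m + 2)) ∧
      Rauzy.IsPullbackOver (Rauzy.sameInvariant m) (Rauzy.sameInvariant (m + 2)) Tbar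
        (Rauzy.targetClasses (m + 2))) := by
  refine ⟨fun C hC => ?_, fun hm => ?_⟩
  · obtain ⟨ρ, h0, hρ⟩ := Rauzy.RauzyClass.exists_standard_opT_mem hC
    exact ⟨ρ, Rauzy.isIrreducible_of_apply_zero h0, hρ⟩
  have hsurj : Set.SurjOn (Rauzy.RauzyClass.opT hm) {B | B.Primitive}
      (Rauzy.targetClasses (m + 2)) := by
    intro C hC
    obtain ⟨ρ, h0, hρ⟩ := Rauzy.RauzyClass.exists_standard_opT_mem hC
    have hB := Rauzy.RauzyClass.opT_mk hm (h := Rauzy.isIrreducible_of_apply_zero h0) hρ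
    exact ⟨_, fun σ hσ => Rauzy.opT_primitive
      (hC.2.1 _ (hB ▸ Rauzy.RauzyClass.opT_mem hm hσ)), hB⟩
  refine ⟨Rauzy.RauzyClass.opT hm, fun B σ hσ => Rauzy.RauzyClass.opT_mem hm hσ, hsurj,
    Quotient.map _ fun B B' h => (Rauzy.RauzyClass.invariants_opT_eq_iff hm B B').2 h,
    fun _ => rfl, fun C hC y hy => ?_⟩
  obtain ⟨B, -, rfl⟩ := hsurj hC
  induction y using Quotient.inductionOn with
  | h B' =>
    -- The invariant of a preimage is determined by that of its image, so any preimage `B` lies in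
    -- the given equivalence class.
    exact ⟨B, Quotient.sound
      ((Rauzy.RauzyClass.invariants_opT_eq_iff hm B B').1 (Quotient.exact hy).symm), rfl⟩
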